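/- Let $k$ be a commutative ring with $\mathbb{Q}\subset k$ (that is, $k$ is a $\mathbb{Q}$-algebra) and let $A$ be a commutative $k$-algebra. A $k$-algebra over $A$ is a (not necessarily commutative) $k$-algebra $R$ with a map of $k$-algebras $\iota:A\to R$. For a non-empty co-ideal $\Delta\subset\mathbb{N}^p$ (a subset closed under passing to smaller elements), write $R[[\mathbf{s}]]_\Delta$ for the quotient of $R[[s_1,\dots,s_p]]$ by the series with zero coefficients at all $\alpha\in\Delta$, $\mathcal{U}^p(R;\Delta)$ for the group of series in it with constant term $1$, and $\mathrm{HS}^p_k(A;\Delta)\subset \mathcal{U}^p(\mathrm{End}_k(A);\Delta)$ for the group of Hasse--Schmidt derivations, i.e. of series $D=\sum_{\alpha\in\Delta} D_\alpha\mathbf{s}^\alpha$ with $D_0=\mathrm{Id}$ and $D_\alpha(xy)=\sum_{\beta+\gamma=\alpha}D_\beta(x)D_\gamma(y)$ for all $\alpha\in\Delta$ and $x,y\in A$. A substitution map is a map of $A$-algebras $\varphi:A[[\mathbf{s}]]_\Delta\to A[[\mathbf{t}]]_\nabla$ such that every $\varphi(s_i)$ has order $\ge 1$; it acts by $\varphi\bullet\sum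 r_\alpha\mathbf{s}^\alpha=\sum\varphi(\mathbf{s}^\alpha)r_\alpha$. An HS-structure on $R$ is a family of group homomorphisms $\Psi^p_\Delta:\mathrm{HS}^p_k(A;\Delta)\to\mathcal{U}^p(R;\Delta)$ (for all $p$ and $\Delta$) such that $\Psi^p_\Delta(D)\,a=\bigl(\sum_\alpha D_\alpha(a)\mathbf{s}^\alpha\bigr)\Psi^p_\Delta(D)$ for all $a\in A$ and $\Psi^q_\nabla(\varphi\bullet D)=\varphi\bullet\Psi^p_\Delta(D)$ for all substitution maps $\varphi$. An LR-admissible map is a left $A$-linear map $\nabla:\mathrm{Der}_k(A)\to R$ with $\nabla(\delta)a=a\nabla(\delta)+\delta(a)$ and $\nabla([\delta,\delta'])=[\nabla(\delta),\nabla(\delta')]$. Let $\mathbb{U}^{\mathrm{HS}}_{A/k}$ be the $k$-algebra over $A$ with the universal HS-structure $\Upsilon$, filtered by giving the image of $A$ weight $0$ and the coefficients $\Upsilon^p_\Delta(D)_\alpha$ weight $|\alpha|$ (the $d$-th step is spanned by the products of these elements of total weight $\le d$), and let $\mathbb{U}^{\mathrm{LR}}_{A/k}$ be the $k$-algebra over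 $A$ with the universal LR-admissible map $\sigma:\mathrm{Der}_k(A)\to\mathbb{U}^{\mathrm{LR}}_{A/k}$ (the enveloping algebra of the Lie--Rinehart algebra $\mathrm{Der}_k(A)$), filtered in the same way with the image of $A$ of weight $0$ and $\sigma(\delta)$ of weight $1$. The identity $\Upsilon^1_{\{0,1\}}(\mathrm{Id}+\delta s)=1+\nabla^{\mathrm{HS}}(\delta)s$ defines an LR-admissible map $\nabla^{\mathrm{HS}}:\mathrm{Der}_k(A)\to\mathbb{U}^{\mathrm{HS}}_{A/k}$; let $\kappa:\mathbb{U}^{\mathrm{LR}}_{A/k}\to\mathbb{U}^{\mathrm{HS}}_{A/k}$ be the unique map of $k$-algebras over $A$ with $\kappa\circ\sigma=\nabla^{\mathrm{HS}}$. Then $\kappa$ is an isomorphism of filtered $k$-algebras over $A$: it is bijective, compatible with the maps from $A$, and maps the $d$-th step of the filtration of $\mathbb{U}^{\mathrm{LR}}_{A/k}$ onto the $d$-th step of the filtration of $\mathbb{U}^{\mathrm{HS}}_{A/k}$ for every $d\ge 0$. -/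

import Mathlib

/-- A non-empty co-ideal of `ℕ^p`: a non-empty subset that is closed downwards. -/
structure Coideal (p : ℕ) where
  carrier : Set (Fin p →₀ ℕ)
  nonempty' : carrier.Nonempty
  lower' : ∀ ⦃α β : Fin p →₀ ℕ⦄, β ∈ carrier → α ≤ β → α ∈ carrier

namespace Coideal

variable {p : ℕ}

instance : Membership (Fin p →₀ ℕ) (Coideal p) := ⟨fun Δ α => α ∈ Δ.carrier⟩

theorem mem_of_le (Δ : Coideal p) {α β : Fin p →₀ ℕ} (hβ : β ∈ Δ) (h : α ≤ β) : α ∈ Δ :=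
  Δ.lower' hβ h

theorem zero_mem (Δ : Coideal p) : (0 : Fin p →₀ ℕ) ∈ Δ := by
  obtain ⟨β, hβ⟩ := Δ.nonempty'
  exact Δ.lower' hβ zero_le

theorem fst_mem (Δ : Coideal p) {α : Fin p →₀ ℕ} (hα : α ∈ Δ)
    {x : (Fin p →₀ ℕ) × (Fin p →₀ ℕ)} (hx : x ∈ Finset.HasAntidiagonal.antidiagonal α) : x.1 ∈ Δ := by
  rw [Finset.HasAntidiagonal.mem_antidiagonal] at hx
  exact Δ.mem_of_le hα (hx ▸ le_self_add)

theorem snd_mem (Δ : Coideal p) {α : Fin p →₀ ℕ} (hα : α ∈ Δ)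
    {x : (Fin p →₀ ℕ) × (Fin p →₀ ℕ)} (hx : x ∈ Finset.HasAntidiagonal.antidiagonal α) : x.2 ∈ Δ := by
  rw [Finset.HasAntidiagonal.mem_antidiagonal] at hx
  exact Δ.mem_of_le hα (hx ▸ le_add_self)

/-- The co-ideal `{α' | α' ≤ α}`. -/
def below (α : Fin p →₀ ℕ) : Coideal p where
  carrier := {β | β ≤ α}
  nonempty' := ⟨α, le_refl α⟩
  lower' := fun _ _ h h' => le_trans h' h

@[simp] theorem mem_below {α β : Fin p →₀ ℕ} : β ∈ below α ↔ β ≤ α := Iff.rfl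

end Coideal

/-- The two-sided ideal `Δ_R` of `R[[s]]`: the series whose coefficients at all `α ∈ Δ` vanish. -/
def truncIdeal {p : ℕ} (Δ : Coideal p) (R : Type*) [Ring R] :
    Ideal (MvPowerSeries (Fin p) R) where
  carrier := {f | ∀ α ∈ Δ, MvPowerSeries.coeff α f = 0}
  add_mem' := fun {f g} hf hg α hα => by rw [map_add, hf α hα, hg α hα, add_zero]
  zero_mem' := fun α _ => map_zero _
  smul_mem' := fun f g hg α hα => by
    rw [smul_eq_mul, MvPowerSeries.coeff_mul]
    exact Finset.sum_eq_zero fun x hx => by rw [hg _ (Δ.snd_mem hα hx), mul_zero]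

instance truncIdeal_isTwoSided {p : ℕ} (Δ : Coideal p) (R : Type*) [Ring R] :
    (truncIdeal Δ R).IsTwoSided :=
  ⟨fun {f} g hf α hα => by
    rw [MvPowerSeries.coeff_mul]
    exact Finset.sum_eq_zero fun x hx => by rw [hf _ (Δ.fst_mem hα hx), zero_mul]⟩

/-- The ring `R[[s]]_Δ = R[[s]] / Δ_R`, with `s = (s_1, …, s_p)`. -/
abbrev TPS {p : ℕ} (Δ : Coideal p) (R : Type*) [Ring R] : Type _ :=
  MvPowerSeries (Fin p) R ⧸ truncIdeal Δ R

namespace TPS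

variable {p : ℕ} {Δ : Coideal p}

section Ring

variable {R : Type*} [Ring R]

/-- The class of the series `∑ α, f α * s ^ α`. -/
noncomputable def ofFun (Δ : Coideal p) (f : (Fin p →₀ ℕ) → R) : TPS Δ R :=
  Ideal.Quotient.mk (truncIdeal Δ R) (f : MvPowerSeries (Fin p) R)

open Classical in
/-- The coefficient of `s ^ α`, for `α ∈ Δ`; it is `0` for `α ∉ Δ`. -/
noncomputable def coeff (α : Fin p →₀ ℕ) : TPS Δ R →+ R :=
  QuotientAddGroup.lift (truncIdeal Δ R).toAddSubgroup
    (if α ∈ Δ then (MvPowerSeries.coeff (R := R) α).toAddMonoidHom else 0)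
    (fun f hf => by
      by_cases h : α ∈ Δ
      · simpa [h] using hf α h
      · simp [h])

theorem coeff_mk {α : Fin p →₀ ℕ} (hα : α ∈ Δ) (f : MvPowerSeries (Fin p) R) :
    coeff α (Ideal.Quotient.mk (truncIdeal Δ R) f) = MvPowerSeries.coeff α f := by
  refine (QuotientAddGroup.lift_mk' _ _ f).trans ?_
  simp [hα]

theorem coeff_of_notMem {α : Fin p →₀ ℕ} (hα : α ∉ Δ) (f : TPS Δ R) : coeff α f = 0 := by
  obtain ⟨f, rfl⟩ := Ideal.Quotient.mk_surjective f
  refine (QuotientAddGroup.lift_mk' _ _ f).trans ?_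
  simp [hα]

theorem coeff_ofFun {α : Fin p →₀ ℕ} (hα : α ∈ Δ) (f : (Fin p →₀ ℕ) → R) :
    coeff α (ofFun Δ f) = f α := coeff_mk hα _

theorem ext {f g : TPS Δ R} (h : ∀ α ∈ Δ, coeff α f = coeff α g) : f = g := by
  obtain ⟨f, rfl⟩ := Ideal.Quotient.mk_surjective f
  obtain ⟨g, rfl⟩ := Ideal.Quotient.mk_surjective g
  rw [Ideal.Quotient.eq]
  intro α hα
  have := h α hα
  rw [coeff_mk hα, coeff_mk hα] at this
  rw [map_sub, this, sub_self]

theorem ofFun_coeff (f : TPS Δ R) : ofFun Δ (fun α => coeff α f) = f :=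
  ext fun _ hα => coeff_ofFun hα _

theorem coeff_mul {α : Fin p →₀ ℕ} (hα : α ∈ Δ) (f g : TPS Δ R) :
    coeff α (f * g) = ∑ x ∈ Finset.HasAntidiagonal.antidiagonal α, coeff x.1 f * coeff x.2 g := by
  obtain ⟨f, rfl⟩ := Ideal.Quotient.mk_surjective f
  obtain ⟨g, rfl⟩ := Ideal.Quotient.mk_surjective g
  rw [← map_mul, coeff_mk hα, MvPowerSeries.coeff_mul]
  refine Finset.sum_congr rfl fun x hx => ?_
  rw [coeff_mk (Δ.fst_mem hα hx), coeff_mk (Δ.snd_mem hα hx)]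

theorem coeff_zero_mul (f g : TPS Δ R) : coeff 0 (f * g) = coeff 0 f * coeff 0 g := by
  rw [coeff_mul Δ.zero_mem]; simp

theorem coeff_one {α : Fin p →₀ ℕ} (hα : α ∈ Δ) :
    coeff α (1 : TPS Δ R) = if α = 0 then 1 else 0 := by
  classical
  rw [← map_one (Ideal.Quotient.mk (truncIdeal Δ R)), coeff_mk hα, MvPowerSeries.coeff_one]

theorem coeff_zero_one : coeff 0 (1 : TPS Δ R) = 1 := by
  rw [coeff_one Δ.zero_mem, if_pos rfl]

/-- The constant series. -/
noncomputable def C (Δ : Coideal p) (a : R) : TPS Δ R :=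
  Ideal.Quotient.mk (truncIdeal Δ R) (MvPowerSeries.C a)

/-- The class of `a * s ^ β`. -/
noncomputable def monomial (Δ : Coideal p) (β : Fin p →₀ ℕ) (a : R) : TPS Δ R :=
  Ideal.Quotient.mk (truncIdeal Δ R) (MvPowerSeries.monomial β a)

theorem coeff_monomial {α : Fin p →₀ ℕ} (hα : α ∈ Δ) (β : Fin p →₀ ℕ) (a : R) :
    coeff α (monomial Δ β a) = if α = β then a else 0 := by
  classical
  rw [monomial, coeff_mk hα, MvPowerSeries.coeff_monomial]

theorem monomial_mul (β γ : Fin p →₀ ℕ) (a b : R) :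
    monomial Δ β a * monomial Δ γ b = monomial Δ (β + γ) (a * b) := by
  rw [monomial, monomial, ← map_mul, MvPowerSeries.monomial_mul_monomial]
  rfl

theorem monomial_add (β : Fin p →₀ ℕ) (a b : R) :
    monomial Δ β (a + b) = monomial Δ β a + monomial Δ β b := by
  simp only [monomial, map_add]

theorem monomial_of_notMem {β : Fin p →₀ ℕ} (hβ : β ∉ Δ) (a : R) : monomial Δ β a = 0 :=
  ext fun α hα => by
    rw [coeff_monomial hα, map_zero, if_neg]
    rintro rfl
    exact hβ hα

theorem coeff_mul_C (α : Fin p →₀ ℕ) (f : TPS Δ R) (a : R) :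
    coeff α (f * C Δ a) = coeff α f * a := by
  by_cases hα : α ∈ Δ
  · obtain ⟨f, rfl⟩ := Ideal.Quotient.mk_surjective f
    rw [C, ← map_mul, coeff_mk hα, coeff_mk hα, MvPowerSeries.coeff_mul_C]
  · rw [coeff_of_notMem hα, coeff_of_notMem hα, zero_mul]

/-- The series with constant coefficient `1`; all of them are units of `R[[s]]_Δ`
(`TPS.isUnit_of_mem_U`), so that this is the group `U^p(R; Δ)`. -/
noncomputable def U (Δ : Coideal p) (R : Type*) [Ring R] : Submonoid (TPS Δ R) where
  carrier := {r | coeff 0 r = 1}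
  mul_mem' := fun {a b} ha hb => by
    change coeff 0 a = 1 at ha; change coeff 0 b = 1 at hb; change coeff 0 (a * b) = 1
    rw [coeff_zero_mul, ha, hb, one_mul]
  one_mem' := coeff_zero_one

theorem isUnit_of_mem_U {r : TPS Δ R} (hr : r ∈ U Δ R) : IsUnit r := by
  obtain ⟨f, rfl⟩ := Ideal.Quotient.mk_surjective r
  have hf : MvPowerSeries.constantCoeff f = ((1 : Rˣ) : R) := by
    have : coeff 0 (Ideal.Quotient.mk (truncIdeal Δ R) f) = 1 := hr
    rw [coeff_mk Δ.zero_mem] at this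
    simpa using this
  exact IsUnit.map (Ideal.Quotient.mk (truncIdeal Δ R))
    ⟨⟨f, _, MvPowerSeries.mul_invOfUnit f 1 hf, MvPowerSeries.invOfUnit_mul f 1 hf⟩, rfl⟩

/-- Application of an additive map to all coefficients. -/
noncomputable def mapCoeff {R' : Type*} [Ring R'] (f : R →+ R') (r : TPS Δ R) : TPS Δ R' :=
  ofFun Δ fun α => f (coeff α r)

theorem coeff_mapCoeff {R' : Type*} [Ring R'] (f : R →+ R') (r : TPS Δ R) (α : Fin p →₀ ℕ) :
    coeff α (mapCoeff f r) = f (coeff α r) := by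
  by_cases hα : α ∈ Δ
  · exact coeff_ofFun hα _
  · rw [coeff_of_notMem hα, coeff_of_notMem hα, map_zero]

end Ring

section CommRing

variable {A : Type*} [CommRing A]

theorem coeff_smul (α : Fin p →₀ ℕ) (a : A) (f : TPS Δ A) : coeff α (a • f) = a * coeff α f := by
  by_cases hα : α ∈ Δ
  · obtain ⟨f, rfl⟩ := Ideal.Quotient.mk_surjective f
    have h : a • Ideal.Quotient.mk (truncIdeal Δ A) f = Ideal.Quotient.mk (truncIdeal Δ A) (a • f) :=
      rfl
    rw [h, coeff_mk hα, coeff_mk hα]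
    simp
  · rw [coeff_of_notMem hα, coeff_of_notMem hα, mul_zero]

theorem coeff_algebraMap {α : Fin p →₀ ℕ} (hα : α ∈ Δ) (a : A) :
    coeff α (algebraMap A (TPS Δ A) a) = if α = 0 then a else 0 := by
  rw [Algebra.algebraMap_eq_smul_one, coeff_smul, coeff_one hα]
  simp

end CommRing

end TPS

/-- The finite set of all `β ∈ ℕ^p` with `|β| ≤ n`. -/
noncomputable def degreeLE (p n : ℕ) : Finset (Fin p →₀ ℕ) :=
  (Finsupp.finite_of_degree_le (σ := Fin p) n).toFinset

theorem mem_degreeLE {p n : ℕ} {β : Fin p →₀ ℕ} : β ∈ degreeLE p n ↔ β.degree ≤ n := by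
  simp [degreeLE]

theorem MvPowerSeries.exists_eq_sum_monomial_mul {p : ℕ} {A : Type*} [CommRing A]
    (g : MvPowerSeries (Fin p) A) (hg : MvPowerSeries.coeff 0 g = 0) :
    ∃ G : Fin p → MvPowerSeries (Fin p) A,
      g = ∑ i, MvPowerSeries.monomial (Finsupp.single i 1) (1 : A) * G i ∧
      ∀ i γ, MvPowerSeries.coeff γ (G i) = 0 ∨
        MvPowerSeries.coeff γ (G i) = MvPowerSeries.coeff (γ + Finsupp.single i 1) g := by
  classical
  let G : Fin p → MvPowerSeries (Fin p) A := fun i γ =>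
    if ∀ j < i, γ j = 0 then MvPowerSeries.coeff (γ + Finsupp.single i 1) g else 0
  have hG : ∀ i γ, MvPowerSeries.coeff γ (G i) =
    if ∀ j < i, γ j = 0 then MvPowerSeries.coeff (γ + Finsupp.single i 1) g else 0 :=
    fun _ _ => rfl
  refine ⟨G, ?_, ?_⟩
  · ext β
    rw [map_sum]
    simp only [MvPowerSeries.coeff_monomial_mul, one_mul, hG]
    by_cases hβ : β = 0
    · subst hβ
      rw [hg]
      refine (Finset.sum_eq_zero fun i _ => if_neg fun h => ?_).symm
      have := h i
      simp at this
    · have hne : β.support.Nonempty := by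
        rwa [Finset.nonempty_iff_ne_empty, Ne, Finsupp.support_eq_empty]
      have hmem := β.support.min'_mem hne
      have hmin : ∀ j, β j ≠ 0 → β.support.min' hne ≤ j := fun j hj =>
        β.support.min'_le j (Finsupp.mem_support_iff.2 hj)
      generalize β.support.min' hne = i at hmem hmin
      have hi : Finsupp.single i 1 ≤ β := by
        rw [Finsupp.single_le_iff]
        exact Nat.one_le_iff_ne_zero.2 (Finsupp.mem_support_iff.1 hmem)
      rw [Finset.sum_eq_single i]
      · rw [if_pos hi, if_pos, tsub_add_cancel_of_le hi]
        intro j hj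
        by_contra h
        refine absurd (hmin j fun h0 => h ?_) (not_le.2 hj)
        simp [h0]
      · intro j _ hj
        by_cases hjβ : Finsupp.single j 1 ≤ β
        · rw [if_pos hjβ, if_neg]
          intro h
          have hj0 : β j ≠ 0 := Nat.one_le_iff_ne_zero.1 (Finsupp.single_le_iff.1 hjβ)
          have h1 := h i (lt_of_le_of_ne (hmin j hj0) (Ne.symm hj))
          rw [Finsupp.tsub_apply, Finsupp.single_eq_of_ne (Ne.symm hj), tsub_zero] at h1
          exact Finsupp.mem_support_iff.1 hmem h1
        · rw [if_neg hjβ]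
      · intro h
        exact absurd (Finset.mem_univ i) h
  · intro i γ
    rw [hG]
    split_ifs
    · exact Or.inr rfl
    · exact Or.inl rfl

/-- A substitution map `A[[s]]_Δ → A[[t]]_Γ`: a map of `A`-algebras that sends every variable
`s_i` to a series of order at least `1`. -/
structure SubstMap (A : Type*) [CommRing A] {p q : ℕ} (Δ : Coideal p) (Γ : Coideal q) where
  toAlgHom : TPS Δ A →ₐ[A] TPS Γ A
  ord_pos : ∀ i : Fin p,
    TPS.coeff 0 (toAlgHom (TPS.monomial Δ (Finsupp.single i 1) 1)) = 0

namespace SubstMap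

variable {A : Type*} [CommRing A] {p q : ℕ} {Δ : Coideal p} {Γ : Coideal q}

theorem coeff_apply_mk_eq_zero (φ : SubstMap A Δ Γ) (N : ℕ) :
    ∀ g : MvPowerSeries (Fin p) A,
      (∀ β, β.degree < N → MvPowerSeries.coeff β g = 0) →
      ∀ e ∈ Γ, e.degree < N →
        TPS.coeff e (φ.toAlgHom (Ideal.Quotient.mk (truncIdeal Δ A) g)) = 0 := by
  induction N with
  | zero => intro g _ e _ h; exact absurd h (Nat.not_lt_zero _)
  | succ N ih =>
    intro g hg e he hN
    obtain ⟨G, hG, hG'⟩ := MvPowerSeries.exists_eq_sum_monomial_mul g (hg 0 (by simp))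
    rw [hG, map_sum, map_sum, map_sum]
    refine Finset.sum_eq_zero fun i _ => ?_
    rw [map_mul, map_mul, TPS.coeff_mul he]
    refine Finset.sum_eq_zero fun x hx => ?_
    have hxe := Finset.HasAntidiagonal.mem_antidiagonal.1 hx
    by_cases hx0 : x.1 = 0
    · have h0 : TPS.coeff 0 (φ.toAlgHom (Ideal.Quotient.mk (truncIdeal Δ A)
          (MvPowerSeries.monomial (Finsupp.single i 1) 1))) = 0 := φ.ord_pos i
      rw [hx0, h0, zero_mul]
    · have h1 : x.1.degree ≠ 0 := fun h => hx0 ((Finsupp.degree_eq_zero_iff _).1 h)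
      have h2 : x.1.degree + x.2.degree = e.degree := by rw [← map_add, hxe]
      rw [ih (G i) ?_ x.2 (Γ.snd_mem he hx) (by omega), mul_zero]
      intro β hβ
      rcases hG' i β with h | h
      · exact h
      · rw [h]
        apply hg
        rw [map_add, Finsupp.degree_single]
        omega

theorem coeff_monomial_eq_zero (φ : SubstMap A Δ Γ) {β : Fin p →₀ ℕ} {e : Fin q →₀ ℕ}
    (h : e.degree < β.degree) (a : A) :
    TPS.coeff e (φ.toAlgHom (TPS.monomial Δ β a)) = 0 := by
  classical
  by_cases he : e ∈ Γ
  · refine φ.coeff_apply_mk_eq_zero β.degree _ (fun γ hγ => ?_) e he h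
    rw [MvPowerSeries.coeff_monomial, if_neg]
    rintro rfl
    exact lt_irrefl _ hγ
  · exact TPS.coeff_of_notMem he _

theorem coeff_apply (φ : SubstMap A Δ Γ) (f : TPS Δ A) {e : Fin q →₀ ℕ} (he : e ∈ Γ) :
    TPS.coeff e (φ.toAlgHom f) = ∑ β ∈ degreeLE p e.degree,
      TPS.coeff e (φ.toAlgHom (TPS.monomial Δ β 1)) * TPS.coeff β f := by
  classical
  let g : MvPowerSeries (Fin p) A := fun β => if β.degree ≤ e.degree then 0 else TPS.coeff β f
  have hgc : ∀ β, MvPowerSeries.coeff β g =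
    if β.degree ≤ e.degree then 0 else TPS.coeff β f := fun _ => rfl
  have hf : f = (∑ β ∈ degreeLE p e.degree, TPS.coeff β f • TPS.monomial Δ β 1) +
      Ideal.Quotient.mk (truncIdeal Δ A) g := by
    refine TPS.ext fun α hα => ?_
    rw [map_add, map_sum, TPS.coeff_mk hα, hgc]
    simp only [TPS.coeff_smul, TPS.coeff_monomial hα, mul_ite, mul_one, mul_zero,
      Finset.sum_ite_eq, mem_degreeLE]
    split_ifs <;> simp
  have hz : TPS.coeff e (φ.toAlgHom (Ideal.Quotient.mk (truncIdeal Δ A) g)) = 0 := by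
    refine φ.coeff_apply_mk_eq_zero (e.degree + 1) g (fun β hβ => ?_) e he (Nat.lt_succ_self _)
    rw [hgc, if_pos (Nat.lt_succ_iff.1 hβ)]
  conv_lhs => rw [hf]
  rw [map_add, map_add, hz, add_zero, map_sum, map_sum]
  refine Finset.sum_congr rfl fun β _ => ?_
  rw [map_smul, TPS.coeff_smul, mul_comm]

/-- The left action `φ • r = ∑ β, φ(s ^ β) r_β` of a substitution map on `R[[s]]_Δ`, for a
`k`-algebra `R` over `A` with structure map `ι`. The coefficient of `t ^ e` is a finite sum, as
`φ(s ^ β)` has no term of degree `< |β|` (`SubstMap.coeff_monomial_eq_zero`). -/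
noncomputable def bullet (φ : SubstMap A Δ Γ) {R : Type*} [Ring R] (ι : A →+* R) (r : TPS Δ R) :
    TPS Γ R :=
  TPS.ofFun Γ fun e => ∑ β ∈ degreeLE p e.degree,
    ι (TPS.coeff e (φ.toAlgHom (TPS.monomial Δ β 1))) * TPS.coeff β r

theorem coeff_bullet (φ : SubstMap A Δ Γ) {R : Type*} [Ring R] (ι : A →+* R) (r : TPS Δ R)
    {e : Fin q →₀ ℕ} (he : e ∈ Γ) :
    TPS.coeff e (φ.bullet ι r) = ∑ β ∈ degreeLE p e.degree,
      ι (TPS.coeff e (φ.toAlgHom (TPS.monomial Δ β 1))) * TPS.coeff β r :=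
  TPS.coeff_ofFun he _

theorem coeff_zero_bullet (φ : SubstMap A Δ Γ) {R : Type*} [Ring R] (ι : A →+* R)
    (r : TPS Δ R) : TPS.coeff 0 (φ.bullet ι r) = TPS.coeff 0 r := by
  have h1 : (TPS.monomial Δ 0 1 : TPS Δ A) = 1 := by
    rw [TPS.monomial, MvPowerSeries.monomial_zero_one, map_one]
  rw [φ.coeff_bullet ι r Γ.zero_mem, Finset.sum_eq_single 0]
  · rw [h1, map_one, TPS.coeff_zero_one, map_one, one_mul]
  · intro β hβ h0
    rw [mem_degreeLE, map_zero] at hβ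
    exact absurd ((Finsupp.degree_eq_zero_iff β).1 (Nat.le_zero.1 hβ)) h0
  · intro h
    exact absurd (mem_degreeLE.2 (by simp)) h

end SubstMap

section HasseSchmidt

variable (k A : Type*) [CommRing k] [CommRing A] [Algebra k A]

theorem sum_antidiagonal_four {X M : Type*} [AddCommMonoid X] [Finset.HasAntidiagonal X]
    [AddCommMonoid M] (F : X → X → X → X → M) (α : X) :
    ∑ z ∈ Finset.HasAntidiagonal.antidiagonal α,
      ∑ u ∈ Finset.HasAntidiagonal.antidiagonal z.1,
        ∑ v ∈ Finset.HasAntidiagonal.antidiagonal z.2, F u.1 u.2 v.1 v.2 =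
    ∑ z ∈ Finset.HasAntidiagonal.antidiagonal α,
      ∑ u ∈ Finset.HasAntidiagonal.antidiagonal z.1,
        ∑ v ∈ Finset.HasAntidiagonal.antidiagonal z.2, F u.1 v.1 u.2 v.2 := by
  simp_rw [← Finset.sum_product', Finset.sum_sigma']
  refine Finset.sum_nbij'
    (fun x => ⟨(x.2.1.1 + x.2.2.1, x.2.1.2 + x.2.2.2), ((x.2.1.1, x.2.2.1), (x.2.1.2, x.2.2.2))⟩)
    (fun x => ⟨(x.2.1.1 + x.2.2.1, x.2.1.2 + x.2.2.2), ((x.2.1.1, x.2.2.1), (x.2.1.2, x.2.2.2))⟩)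
    ?_ ?_ ?_ ?_ ?_
  · rintro ⟨⟨a, b⟩, ⟨c, d⟩, ⟨e, f⟩⟩ h
    simp only [Finset.mem_sigma, Finset.mem_product, Finset.HasAntidiagonal.mem_antidiagonal] at h ⊢
    obtain ⟨rfl, rfl, rfl⟩ := h
    exact ⟨add_add_add_comm _ _ _ _, by trivial⟩
  · rintro ⟨⟨a, b⟩, ⟨c, d⟩, ⟨e, f⟩⟩ h
    simp only [Finset.mem_sigma, Finset.mem_product, Finset.HasAntidiagonal.mem_antidiagonal] at h ⊢
    obtain ⟨rfl, rfl, rfl⟩ := h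
    exact ⟨add_add_add_comm _ _ _ _, by trivial⟩
  · rintro ⟨⟨a, b⟩, ⟨c, d⟩, ⟨e, f⟩⟩ h
    simp only [Finset.mem_sigma, Finset.mem_product, Finset.HasAntidiagonal.mem_antidiagonal] at h ⊢
    obtain ⟨rfl, rfl, rfl⟩ := h
    rfl
  · rintro ⟨⟨a, b⟩, ⟨c, d⟩, ⟨e, f⟩⟩ h
    simp only [Finset.mem_sigma, Finset.mem_product, Finset.HasAntidiagonal.mem_antidiagonal] at h ⊢
    obtain ⟨rfl, rfl, rfl⟩ := h
    rfl
  · rintro ⟨⟨a, b⟩, ⟨c, d⟩, ⟨e, f⟩⟩ h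
    rfl

variable {p q : ℕ}

/-- The monoid `HS^p_k(A; Δ)` of `(p, Δ)`-variate Hasse–Schmidt derivations `∑ α, D_α s ^ α` of `A`
over `k`, with the product of `End_k(A)[[s]]_Δ` (it is a group). -/
noncomputable def HS (Δ : Coideal p) : Submonoid (TPS Δ (Module.End k A)) where
  carrier := {D | TPS.coeff 0 D = 1 ∧ ∀ α ∈ Δ, ∀ x y : A, TPS.coeff α D (x * y) =
    ∑ z ∈ Finset.HasAntidiagonal.antidiagonal α, TPS.coeff z.1 D x * TPS.coeff z.2 D y}
  mul_mem' := by
    rintro D E ⟨hD0, hD⟩ ⟨hE0, hE⟩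
    refine ⟨by rw [TPS.coeff_zero_mul, hD0, hE0, one_mul], fun α hα x y => ?_⟩
    have key := sum_antidiagonal_four (fun b1 b2 c1 c2 =>
      TPS.coeff b1 D (TPS.coeff c1 E x) * TPS.coeff b2 D (TPS.coeff c2 E y)) α
    have hmul : ∀ β ∈ Δ, ∀ w : A, TPS.coeff β (D * E) w =
        ∑ z ∈ Finset.HasAntidiagonal.antidiagonal β, TPS.coeff z.1 D (TPS.coeff z.2 E w) := by
      intro β hβ w
      rw [TPS.coeff_mul hβ, LinearMap.sum_apply]
      rfl
    rw [hmul α hα]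
    trans ∑ z ∈ Finset.HasAntidiagonal.antidiagonal α,
      ∑ u ∈ Finset.HasAntidiagonal.antidiagonal z.1,
        ∑ v ∈ Finset.HasAntidiagonal.antidiagonal z.2,
          TPS.coeff u.1 D (TPS.coeff v.1 E x) * TPS.coeff u.2 D (TPS.coeff v.2 E y)
    · refine Finset.sum_congr rfl fun z hz => ?_
      rw [hE z.2 (Δ.snd_mem hα hz), map_sum, Finset.sum_comm]
      refine Finset.sum_congr rfl fun v _ => ?_
      exact hD z.1 (Δ.fst_mem hα hz) _ _
    · refine key.trans (Finset.sum_congr rfl fun z hz => ?_)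
      rw [hmul z.1 (Δ.fst_mem hα hz), hmul z.2 (Δ.snd_mem hα hz), Finset.sum_mul_sum]
  one_mem' := by
    refine ⟨TPS.coeff_zero_one, fun α hα x y => ?_⟩
    rw [TPS.coeff_one hα]
    by_cases h : α = 0
    · subst h
      simp [TPS.coeff_zero_one]
    · rw [if_neg h]
      refine (Finset.sum_eq_zero fun z hz => ?_).symm
      rw [TPS.coeff_one (Δ.fst_mem hα hz), TPS.coeff_one (Δ.snd_mem hα hz)]
      by_cases h1 : z.1 = 0
      · have h2 : z.2 ≠ 0 := fun h2 => h (by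
          rw [← Finset.HasAntidiagonal.mem_antidiagonal.1 hz, h1, h2, add_zero])
        rw [if_neg h2]
        simp
      · rw [if_neg h1]
        simp

variable {k A} {Δ : Coideal p} {Γ : Coideal q}

/-- The series `∑ α, D_α(a) s ^ α`. -/
noncomputable def evalSeries (D : TPS Δ (Module.End k A)) (a : A) : TPS Δ A :=
  TPS.ofFun Δ fun α => TPS.coeff α D a

theorem coeff_evalSeries (D : TPS Δ (Module.End k A)) (a : A) (α : Fin p →₀ ℕ) :
    TPS.coeff α (evalSeries D a) = TPS.coeff α D a := by
  by_cases hα : α ∈ Δ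
  · exact TPS.coeff_ofFun hα _
  · rw [TPS.coeff_of_notMem hα, TPS.coeff_of_notMem hα, LinearMap.zero_apply]

theorem mem_HS_iff {D : TPS Δ (Module.End k A)} :
    D ∈ HS k A Δ ↔ TPS.coeff 0 D = 1 ∧
      ∀ x y, evalSeries D (x * y) = evalSeries D x * evalSeries D y := by
  refine and_congr Iff.rfl ⟨fun h x y => TPS.ext fun α hα => ?_, fun h α hα x y => ?_⟩
  · rw [coeff_evalSeries, TPS.coeff_mul hα, h α hα]
    simp only [coeff_evalSeries]
  · have := congrArg (TPS.coeff α) (h x y)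
    rw [coeff_evalSeries, TPS.coeff_mul hα] at this
    simpa only [coeff_evalSeries] using this

theorem evalSeries_bullet (φ : SubstMap A Δ Γ) (D : TPS Δ (Module.End k A)) (a : A) :
    evalSeries (φ.bullet (Algebra.lmul k A : A →ₐ[k] Module.End k A).toRingHom D) a =
      φ.toAlgHom (evalSeries D a) := by
  refine TPS.ext fun e he => ?_
  rw [coeff_evalSeries, φ.coeff_bullet _ _ he, φ.coeff_apply _ he, LinearMap.sum_apply]
  refine Finset.sum_congr rfl fun β _ => ?_
  rw [coeff_evalSeries]
  rfl

/-- The Hasse–Schmidt derivation `φ • D`. -/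
noncomputable def SubstMap.bulletHS (φ : SubstMap A Δ Γ) (D : HS k A Δ) : HS k A Γ :=
  ⟨φ.bullet (Algebra.lmul k A : A →ₐ[k] Module.End k A).toRingHom D, by
    have hD := mem_HS_iff.1 D.2
    refine mem_HS_iff.2 ⟨?_, fun x y => ?_⟩
    · rw [φ.coeff_zero_bullet, hD.1]
    · rw [evalSeries_bullet, evalSeries_bullet, evalSeries_bullet, hD.2, map_mul]⟩

end HasseSchmidt

/-- A map `∇ : Der_k(A) → R` to a `k`-algebra over `A` (with structure map `ι`) is LR-admissible. -/
structure IsLRAdmissible {k A R : Type*} [CommRing k] [CommRing A] [Algebra k A] [Ring R]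
    [Algebra k R] (ι : A →ₐ[k] R) (nabla : Derivation k A A → R) : Prop where
  map_add : ∀ δ δ', nabla (δ + δ') = nabla δ + nabla δ'
  map_smul : ∀ (a : A) δ, nabla (a • δ) = ι a * nabla δ
  leibniz : ∀ δ (a : A), nabla δ * ι a = ι a * nabla δ + ι (δ a)
  map_lie : ∀ δ δ', nabla ⁅δ, δ'⁆ = nabla δ * nabla δ' - nabla δ' * nabla δ

/-- An HS-structure over `A/k` on a `k`-algebra `R` over `A` with structure map `ι`. -/
structure HSStructure {k A R : Type*} [CommRing k] [CommRing A] [Algebra k A] [Ring R]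
    [Algebra k R] (ι : A →ₐ[k] R) where
  toHom : ∀ {p : ℕ} (Δ : Coideal p), HS k A Δ →* TPS.U Δ R
  leibniz : ∀ {p : ℕ} (Δ : Coideal p) (D : HS k A Δ) (a : A),
    (toHom Δ D : TPS Δ R) * TPS.C Δ (ι a) =
      TPS.mapCoeff (ι : A →+ R) (evalSeries (D : TPS Δ (Module.End k A)) a) * toHom Δ D
  subst : ∀ {p q : ℕ} (Δ : Coideal p) (Γ : Coideal q) (φ : SubstMap A Δ Γ) (D : HS k A Δ),
    (toHom Γ (φ.bulletHS D) : TPS Γ R) = φ.bullet ι.toRingHom (toHom Δ D)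

/-- The filtration of an algebra `U` defined by a family of elements `g` with weights `w`: its
`d`-th step is spanned by the products of elements of the family of total weight at most `d`. -/
def wordFil (k : Type*) {U X : Type*} [CommRing k] [Ring U] [Algebra k U] (g : X → U) (w : X → ℕ)
    (d : ℕ) : Submodule k U :=
  Submodule.span k {u | ∃ l : List X, (l.map w).sum ≤ d ∧ (l.map g).prod = u}

theorem mul_mem_wordFil {k U X : Type*} [CommRing k] [Ring U] [Algebra k U] {g : X → U} {w : X → ℕ}
    {d e : ℕ} {u v : U} (hu : u ∈ wordFil k g w d) (hv : v ∈ wordFil k g w e) :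
    u * v ∈ wordFil k g w (d + e) := by
  have h := Submodule.mul_mem_mul hu hv
  rw [wordFil, wordFil, Submodule.span_mul_span] at h
  refine Submodule.span_mono ?_ h
  rintro _ ⟨_, ⟨l, hl, rfl⟩, _, ⟨m, hm, rfl⟩, rfl⟩
  exact ⟨l ++ m, by simpa using add_le_add hl hm, by simp⟩

theorem wordFil_mono (k : Type*) {U X : Type*} [CommRing k] [Ring U] [Algebra k U] (g : X → U)
    (w : X → ℕ) : Monotone (wordFil k g w) := fun _ _ h =>
  Submodule.span_mono fun _ ⟨l, hl, hu⟩ => ⟨l, hl.trans h, hu⟩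

theorem gen_mem_wordFil {k U X : Type*} [CommRing k] [Ring U] [Algebra k U] (g : X → U) (w : X → ℕ)
    (x : X) : g x ∈ wordFil k g w (w x) :=
  Submodule.subset_span ⟨[x], by simp, by simp⟩

/-! ### The enveloping algebra of the Lie–Rinehart algebra `Der_k(A)` -/

section LR

variable (k A : Type*) [CommRing k] [CommRing A] [Algebra k A]

/-- Generators of the enveloping algebra: the elements of `A` and the derivations. -/
inductive LRGen
  | coef (a : A)
  | der (δ : Derivation k A A)

variable {k A} in
/-- The weight of a generator: `0` for the elements of `A` and `1` for the derivations. -/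
def LRGen.weight : LRGen k A → ℕ
  | coef _ => 0
  | der _ => 1

/-- The generator of the free algebra given by `a : A`. -/
noncomputable def LRGen.c (a : A) : FreeAlgebra k (LRGen k A) := FreeAlgebra.ι k (.coef a)

variable {A} in
/-- The generator of the free algebra given by a derivation. -/
noncomputable def LRGen.d (δ : Derivation k A A) : FreeAlgebra k (LRGen k A) :=
  FreeAlgebra.ι k (.der δ)

open LRGen in
/-- The defining relations: `A` maps by a map of `k`-algebras, `Der_k(A)` by an LR-admissible
map. -/
inductive LRRel : FreeAlgebra k (LRGen k A) → FreeAlgebra k (LRGen k A) → Prop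
  | coef_algebraMap (r : k) : LRRel (c k A (algebraMap k A r)) (algebraMap k _ r)
  | coef_add (a b : A) : LRRel (c k A (a + b)) (c k A a + c k A b)
  | coef_mul (a b : A) : LRRel (c k A (a * b)) (c k A a * c k A b)
  | der_add (δ δ' : Derivation k A A) : LRRel (d k (δ + δ')) (d k δ + d k δ')
  | der_smul (a : A) (δ : Derivation k A A) : LRRel (d k (a • δ)) (c k A a * d k δ)
  | leibniz (δ : Derivation k A A) (a : A) : LRRel (d k δ * c k A a) (c k A a * d k δ + c k A (δ a))
  | der_lie (δ δ' : Derivation k A A) : LRRel (d k ⁅δ, δ'⁆) (d k δ * d k δ' - d k δ' * d k δ)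

/-- The enveloping algebra `U^LR` of the Lie–Rinehart algebra `Der_k(A)`. -/
abbrev ULR : Type _ := RingQuot (LRRel k A)

namespace ULR

/-- The structure map `A → U^LR`. -/
noncomputable def ι : A →ₐ[k] ULR k A where
  toFun a := RingQuot.mkAlgHom k (LRRel k A) (LRGen.c k A a)
  map_one' := by
    rw [← map_one (algebraMap k A), RingQuot.mkAlgHom_rel k (LRRel.coef_algebraMap (A := A) 1),
      map_one, map_one]
  map_mul' a b := by rw [RingQuot.mkAlgHom_rel k (LRRel.coef_mul a b), map_mul]
  map_zero' := by
    rw [← map_zero (algebraMap k A), RingQuot.mkAlgHom_rel k (LRRel.coef_algebraMap (A := A) 0),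
      map_zero, map_zero]
  map_add' a b := by rw [RingQuot.mkAlgHom_rel k (LRRel.coef_add a b), map_add]
  commutes' r := by
    rw [RingQuot.mkAlgHom_rel k (LRRel.coef_algebraMap (A := A) r), AlgHom.commutes]

/-- The universal LR-admissible map `Der_k(A) → U^LR`. -/
noncomputable def σ (δ : Derivation k A A) : ULR k A :=
  RingQuot.mkAlgHom k (LRRel k A) (LRGen.d k δ)

theorem isLRAdmissible_σ : IsLRAdmissible (ι k A) (σ k A) where
  map_add δ δ' := by rw [σ, RingQuot.mkAlgHom_rel k (LRRel.der_add δ δ'), map_add]; rfl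
  map_smul a δ := by rw [σ, RingQuot.mkAlgHom_rel k (LRRel.der_smul a δ), map_mul]; rfl
  leibniz δ a := by
    have := RingQuot.mkAlgHom_rel k (LRRel.leibniz δ a)
    rw [map_mul, map_add, map_mul] at this
    exact this
  map_lie δ δ' := by
    rw [σ, RingQuot.mkAlgHom_rel k (LRRel.der_lie δ δ'), map_sub, map_mul, map_mul]; rfl

variable {k A}

/-- The filtration of `U^LR`: the elements of `A` have weight `0`, the derivations weight `1`. -/
noncomputable def fil (d : ℕ) : Submodule k (ULR k A) :=
  wordFil k (fun x => RingQuot.mkAlgHom k (LRRel k A) (FreeAlgebra.ι k x)) LRGen.weight d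

variable {R : Type*} [Ring R] [Algebra k R]

/-- The values of a map out of `U^LR` on the generators. -/
def genMap (f : A → R) (nabla : Derivation k A A → R) : LRGen k A → R
  | .coef a => f a
  | .der δ => nabla δ

/-- The map of `k`-algebras over `A` induced by an LR-admissible map. -/
noncomputable def lift {f : A →ₐ[k] R} {nabla : Derivation k A A → R}
    (h : IsLRAdmissible f nabla) : ULR k A →ₐ[k] R :=
  RingQuot.liftAlgHom k ⟨FreeAlgebra.lift k (genMap f nabla), by
    have hc : ∀ a, FreeAlgebra.lift k (genMap f nabla) (LRGen.c k A a) = f a :=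
      fun a => FreeAlgebra.lift_ι_apply _ _
    have hd : ∀ δ, FreeAlgebra.lift k (genMap f nabla) (LRGen.d k δ) = nabla δ :=
      fun δ => FreeAlgebra.lift_ι_apply _ _
    intro x y hxy
    cases hxy with
    | coef_algebraMap r => rw [hc, AlgHom.commutes, AlgHom.commutes]
    | coef_add a b => rw [map_add, hc, hc, hc, map_add]
    | coef_mul a b => rw [map_mul, hc, hc, hc, map_mul]
    | der_add δ δ' => rw [map_add, hd, hd, hd, h.map_add]
    | der_smul a δ => rw [map_mul, hd, hd, hc, h.map_smul]
    | leibniz δ a => rw [map_add, map_mul, map_mul, hd, hc, hc, h.leibniz]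
    | der_lie δ δ' => rw [map_sub, map_mul, map_mul, hd, hd, hd, h.map_lie]⟩

theorem lift_ι {f : A →ₐ[k] R} {nabla : Derivation k A A → R} (h : IsLRAdmissible f nabla) (a : A) :
    lift h (ι k A a) = f a :=
  (RingQuot.liftAlgHom_mkAlgHom_apply ..).trans (FreeAlgebra.lift_ι_apply _ _)

theorem lift_σ {f : A →ₐ[k] R} {nabla : Derivation k A A → R} (h : IsLRAdmissible f nabla)
    (δ : Derivation k A A) : lift h (σ k A δ) = nabla δ :=
  (RingQuot.liftAlgHom_mkAlgHom_apply ..).trans (FreeAlgebra.lift_ι_apply _ _)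

theorem hom_ext {f g : ULR k A →ₐ[k] R} (hι : ∀ a, f (ι k A a) = g (ι k A a))
    (hσ : ∀ δ, f (σ k A δ) = g (σ k A δ)) : f = g := by
  refine RingQuot.ringQuot_ext' k f g (FreeAlgebra.hom_ext (funext fun x => ?_))
  cases x with
  | coef a => exact hι a
  | der δ => exact hσ δ

end ULR

end LR

/-! ### The enveloping algebra of Hasse–Schmidt derivations -/

section HSEnvelope

variable (k A : Type*) [CommRing k] [CommRing A] [Algebra k A]

/-- Generators of the enveloping algebra: the elements of `A` and the components `D_α`, `α ∈ Δ`, of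
all `(p, Δ)`-variate Hasse–Schmidt derivations `D`. -/
inductive HSGen
  | coef (a : A)
  | comp {p : ℕ} (Δ : Coideal p) (D : HS k A Δ) (α : Fin p →₀ ℕ) (hα : α ∈ Δ)

variable {k A} in
/-- The weight of a generator: `0` for the elements of `A` and `|α|` for the component `D_α`. -/
noncomputable def HSGen.weight : HSGen k A → ℕ
  | coef _ => 0
  | comp _ _ α _ => α.degree

/-- The generator of the free algebra given by `a : A`. -/
noncomputable def HSGen.c (a : A) : FreeAlgebra k (HSGen k A) := FreeAlgebra.ι k (.coef a)

variable {k A} in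
open Classical in
/-- The generator of the free algebra given by `D_α`; it is `0` for `α ∉ Δ`. -/
noncomputable def HSGen.d {p : ℕ} {Δ : Coideal p} (D : HS k A Δ) (α : Fin p →₀ ℕ) :
    FreeAlgebra k (HSGen k A) :=
  if hα : α ∈ Δ then FreeAlgebra.ι k (.comp Δ D α hα) else 0

open HSGen in
/-- The defining relations, coefficient by coefficient: `A` maps by a map of `k`-algebras, and the
series of the generators `D_α` form an HS-structure. -/
inductive HSRel : FreeAlgebra k (HSGen k A) → FreeAlgebra k (HSGen k A) → Prop
  | coef_algebraMap (r : k) : HSRel (c k A (algebraMap k A r)) (algebraMap k _ r)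
  | coef_add (a b : A) : HSRel (c k A (a + b)) (c k A a + c k A b)
  | coef_mul (a b : A) : HSRel (c k A (a * b)) (c k A a * c k A b)
  | zero {p : ℕ} (Δ : Coideal p) (D : HS k A Δ) : HSRel (d D 0) 1
  | one {p : ℕ} (Δ : Coideal p) (α : Fin p →₀ ℕ) (hα : α ∈ Δ) (h0 : α ≠ 0) :
      HSRel (d (1 : HS k A Δ) α) 0
  | mul {p : ℕ} (Δ : Coideal p) (D E : HS k A Δ) (α : Fin p →₀ ℕ) (hα : α ∈ Δ) :
      HSRel (d (D * E) α) (∑ x ∈ Finset.HasAntidiagonal.antidiagonal α, d D x.1 * d E x.2)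
  | leibniz {p : ℕ} (Δ : Coideal p) (D : HS k A Δ) (a : A) (α : Fin p →₀ ℕ) (hα : α ∈ Δ) :
      HSRel (d D α * c k A a) (∑ x ∈ Finset.HasAntidiagonal.antidiagonal α,
        c k A (TPS.coeff x.1 (D : TPS Δ (Module.End k A)) a) * d D x.2)
  | subst {p q : ℕ} (Δ : Coideal p) (Γ : Coideal q) (φ : SubstMap A Δ Γ) (D : HS k A Δ)
      (e : Fin q →₀ ℕ) (he : e ∈ Γ) :
      HSRel (d (φ.bulletHS D) e) (∑ β ∈ degreeLE p e.degree,
        c k A (TPS.coeff e (φ.toAlgHom (TPS.monomial Δ β 1))) * d D β)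

/-- The enveloping algebra `U^HS` of the Hasse–Schmidt derivations of `A` over `k`. -/
abbrev UHS : Type _ := RingQuot (HSRel k A)

namespace UHS

/-- The structure map `A → U^HS`. -/
noncomputable def ι : A →ₐ[k] UHS k A where
  toFun a := RingQuot.mkAlgHom k (HSRel k A) (HSGen.c k A a)
  map_one' := by
    rw [← map_one (algebraMap k A), RingQuot.mkAlgHom_rel k (HSRel.coef_algebraMap (A := A) 1),
      map_one, map_one]
  map_mul' a b := by rw [RingQuot.mkAlgHom_rel k (HSRel.coef_mul a b), map_mul]
  map_zero' := by
    rw [← map_zero (algebraMap k A), RingQuot.mkAlgHom_rel k (HSRel.coef_algebraMap (A := A) 0),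
      map_zero, map_zero]
  map_add' a b := by rw [RingQuot.mkAlgHom_rel k (HSRel.coef_add a b), map_add]
  commutes' r := by
    rw [RingQuot.mkAlgHom_rel k (HSRel.coef_algebraMap (A := A) r), AlgHom.commutes]

variable {k A}

/-- The image of the generator `D_α` in `U^HS`. -/
noncomputable def comp {p : ℕ} {Δ : Coideal p} (D : HS k A Δ) (α : Fin p →₀ ℕ) : UHS k A :=
  RingQuot.mkAlgHom k (HSRel k A) (HSGen.d D α)

theorem comp_of_notMem {p : ℕ} {Δ : Coideal p} (D : HS k A Δ) {α : Fin p →₀ ℕ} (hα : α ∉ Δ) :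
    comp D α = 0 := by
  rw [comp, HSGen.d, dif_neg hα, map_zero]

theorem comp_zero {p : ℕ} {Δ : Coideal p} (D : HS k A Δ) : comp D 0 = 1 := by
  rw [comp, RingQuot.mkAlgHom_rel k (HSRel.zero Δ D), map_one]

variable (k A) in
/-- The universal HS-structure on `U^HS`. -/
noncomputable def univ : HSStructure (ι k A) where
  toHom {p} Δ :=
    { toFun := fun D => ⟨TPS.ofFun Δ (comp D), (TPS.coeff_ofFun Δ.zero_mem _).trans (comp_zero D)⟩
      map_one' := Subtype.ext (TPS.ext fun α hα => by
        change TPS.coeff α (TPS.ofFun Δ (comp (1 : HS k A Δ))) = TPS.coeff α 1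
        rw [TPS.coeff_ofFun hα, TPS.coeff_one hα]
        split_ifs with h
        · rw [h, comp_zero]
        · rw [comp, RingQuot.mkAlgHom_rel k (HSRel.one Δ α hα h), map_zero])
      map_mul' := fun D E => Subtype.ext (TPS.ext fun α hα => by
        change TPS.coeff α (TPS.ofFun Δ (comp (D * E))) =
          TPS.coeff α (TPS.ofFun Δ (comp D) * TPS.ofFun Δ (comp E))
        rw [TPS.coeff_ofFun hα, TPS.coeff_mul hα, comp,
          RingQuot.mkAlgHom_rel k (HSRel.mul Δ D E α hα), map_sum]
        refine Finset.sum_congr rfl fun x hx => ?_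
        rw [TPS.coeff_ofFun (Δ.fst_mem hα hx), TPS.coeff_ofFun (Δ.snd_mem hα hx), map_mul]
        rfl) }
  leibniz {p} Δ D a := TPS.ext fun α hα => by
    change TPS.coeff α (TPS.ofFun Δ (comp D) * _) = TPS.coeff α (_ * TPS.ofFun Δ (comp D))
    rw [TPS.coeff_mul_C, TPS.coeff_ofFun hα, TPS.coeff_mul hα]
    have h := RingQuot.mkAlgHom_rel k (HSRel.leibniz Δ D a α hα)
    rw [map_mul, map_sum] at h
    refine h.trans (Finset.sum_congr rfl fun x hx => ?_)
    rw [TPS.coeff_ofFun (Δ.snd_mem hα hx), TPS.coeff_mapCoeff, coeff_evalSeries, map_mul]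
    rfl
  subst {p q} Δ Γ φ D := TPS.ext fun e he => by
    change TPS.coeff e (TPS.ofFun Γ (comp (φ.bulletHS D))) =
      TPS.coeff e (φ.bullet _ (TPS.ofFun Δ (comp D)))
    rw [TPS.coeff_ofFun he, φ.coeff_bullet _ _ he, comp,
      RingQuot.mkAlgHom_rel k (HSRel.subst Δ Γ φ D e he), map_sum]
    refine Finset.sum_congr rfl fun β _ => ?_
    rw [map_mul]
    congr 1
    by_cases hβ : β ∈ Δ
    · rw [TPS.coeff_ofFun hβ]
      rfl
    · rw [TPS.coeff_of_notMem hβ]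
      exact comp_of_notMem D hβ

/-- The filtration of `U^HS`: the elements of `A` have weight `0`, the components `D_α` have weight
`|α|`. -/
noncomputable def fil (d : ℕ) : Submodule k (UHS k A) :=
  wordFil k (fun x => RingQuot.mkAlgHom k (HSRel k A) (FreeAlgebra.ι k x)) HSGen.weight d

variable {R : Type*} [Ring R] [Algebra k R]

/-- The values of a map out of `U^HS` on the generators. -/
noncomputable def genMap {f : A →ₐ[k] R} (Ψ : HSStructure f) : HSGen k A → R
  | .coef a => f a
  | .comp Δ D α _ => TPS.coeff α (Ψ.toHom Δ D : TPS Δ R)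

/-- The map of `k`-algebras over `A` induced by an HS-structure. -/
noncomputable def lift {f : A →ₐ[k] R} (Ψ : HSStructure f) : UHS k A →ₐ[k] R :=
  RingQuot.liftAlgHom k ⟨FreeAlgebra.lift k (genMap Ψ), by
    have hc : ∀ a, FreeAlgebra.lift k (genMap Ψ) (HSGen.c k A a) = f a :=
      fun a => FreeAlgebra.lift_ι_apply _ _
    have hd : ∀ {p : ℕ} {Δ : Coideal p} (D : HS k A Δ) (α : Fin p →₀ ℕ),
        FreeAlgebra.lift k (genMap Ψ) (HSGen.d D α) = TPS.coeff α (Ψ.toHom Δ D : TPS Δ R) := by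
      intro p Δ D α
      by_cases hα : α ∈ Δ
      · rw [HSGen.d, dif_pos hα]
        exact FreeAlgebra.lift_ι_apply _ _
      · rw [HSGen.d, dif_neg hα, map_zero, TPS.coeff_of_notMem hα]
    intro x y hxy
    cases hxy with
    | coef_algebraMap r => rw [hc, AlgHom.commutes, AlgHom.commutes]
    | coef_add a b => rw [map_add, hc, hc, hc, map_add]
    | coef_mul a b => rw [map_mul, hc, hc, hc, map_mul]
    | zero Δ D => rw [hd, map_one]; exact (Ψ.toHom Δ D).2
    | one Δ α hα h0 =>
      rw [hd, map_one, map_zero]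
      exact (TPS.coeff_one hα).trans (if_neg h0)
    | mul Δ D E α hα =>
      rw [hd, map_mul, map_sum, Submonoid.coe_mul, TPS.coeff_mul hα]
      refine Finset.sum_congr rfl fun x _ => ?_
      rw [map_mul, hd, hd]
    | leibniz Δ D a α hα =>
      rw [map_mul, hd, hc, map_sum, ← TPS.coeff_mul_C, Ψ.leibniz, TPS.coeff_mul hα]
      refine Finset.sum_congr rfl fun x _ => ?_
      rw [map_mul, hd, hc, TPS.coeff_mapCoeff, coeff_evalSeries]
      rfl
    | subst Δ Γ φ D e he =>
      rw [hd, map_sum, Ψ.subst, φ.coeff_bullet _ _ he]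
      refine Finset.sum_congr rfl fun β _ => ?_
      rw [map_mul, hd, hc]
      rfl⟩

theorem lift_ι {f : A →ₐ[k] R} (Ψ : HSStructure f) (a : A) : lift Ψ (ι k A a) = f a :=
  (RingQuot.liftAlgHom_mkAlgHom_apply ..).trans (FreeAlgebra.lift_ι_apply _ _)

theorem lift_univ {f : A →ₐ[k] R} (Ψ : HSStructure f) {p : ℕ} (Δ : Coideal p) (D : HS k A Δ) :
    TPS.mapCoeff (lift Ψ : UHS k A →+ R) ((univ k A).toHom Δ D : TPS Δ (UHS k A)) =
      Ψ.toHom Δ D := by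
  refine TPS.ext fun α hα => ?_
  rw [TPS.coeff_mapCoeff]
  change lift Ψ (TPS.coeff α (TPS.ofFun Δ (comp D))) = _
  rw [TPS.coeff_ofFun hα, comp, HSGen.d, dif_pos hα]
  exact (RingQuot.liftAlgHom_mkAlgHom_apply ..).trans (FreeAlgebra.lift_ι_apply _ _)

theorem hom_ext {f g : UHS k A →ₐ[k] R} (hι : ∀ a, f (ι k A a) = g (ι k A a))
    (hΨ : ∀ {p : ℕ} (Δ : Coideal p) (D : HS k A Δ),
      TPS.mapCoeff (f : UHS k A →+ R) ((univ k A).toHom Δ D : TPS Δ (UHS k A)) =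
        TPS.mapCoeff (g : UHS k A →+ R) ((univ k A).toHom Δ D : TPS Δ (UHS k A))) : f = g := by
  refine RingQuot.ringQuot_ext' k f g (FreeAlgebra.hom_ext (funext fun x => ?_))
  cases x with
  | coef a => exact hι a
  | @comp p Δ D α hα =>
    have h := congrArg (TPS.coeff α) (hΨ Δ D)
    rw [TPS.coeff_mapCoeff, TPS.coeff_mapCoeff] at h
    change f (TPS.coeff α (TPS.ofFun Δ (comp D))) = g (TPS.coeff α (TPS.ofFun Δ (comp D))) at h
    rw [TPS.coeff_ofFun hα, comp, HSGen.d, dif_pos hα] at h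
    exact h

end UHS

end HSEnvelope

/-! ### The LR-admissible map of an HS-structure, and the map `κ` -/

/-- The exponent `1 ∈ ℕ^1`; the co-ideal `{0, 1} ⊂ ℕ` is `Coideal.below expOne`. -/
noncomputable def expOne : Fin 1 →₀ ℕ := Finsupp.single 0 1

theorem expOne_ne_zero : expOne ≠ 0 := by simp [expOne]

theorem le_expOne {α : Fin 1 →₀ ℕ} (h : α ≤ expOne) : α = 0 ∨ α = expOne := by
  have h0 := h 0
  simp only [expOne, Finsupp.single_eq_same] at h0
  have : α 0 = 0 ∨ α 0 = 1 := by omega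
  refine this.imp (fun h => Finsupp.ext fun i => ?_) (fun h => Finsupp.ext fun i => ?_)
  · rw [Subsingleton.elim i 0, h, Finsupp.zero_apply]
  · rw [Subsingleton.elim i 0, h, expOne, Finsupp.single_eq_same]

theorem antidiagonal_expOne : Finset.HasAntidiagonal.antidiagonal expOne =
    {(0, expOne), (expOne, 0)} := by
  ext ⟨a, b⟩
  rw [Finset.HasAntidiagonal.mem_antidiagonal]
  simp only [Finset.mem_insert, Finset.mem_singleton, Prod.mk.injEq]
  constructor
  · intro h
    rcases le_expOne (h ▸ le_self_add : a ≤ expOne) with rfl | rfl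
    · left; simpa using h
    · right; simpa using h
  · rintro (⟨rfl, rfl⟩ | ⟨rfl, rfl⟩) <;> simp

namespace TPS

theorem coeff_expOne_mul {R : Type*} [Ring R] (f g : TPS (Coideal.below expOne) R) :
    coeff expOne (f * g) = coeff 0 f * coeff expOne g + coeff expOne f * coeff 0 g := by
  rw [coeff_mul (Coideal.mem_below.2 le_rfl), antidiagonal_expOne, Finset.sum_pair]
  simp [expOne_ne_zero.symm]

theorem eq_of_mem_U {R : Type*} [Ring R] {r : TPS (Coideal.below expOne) R}
    (hr : r ∈ U (Coideal.below expOne) R) :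
    r = 1 + monomial _ expOne (coeff expOne r) := by
  refine ext fun α hα => ?_
  rw [map_add, coeff_one hα, coeff_monomial hα]
  rcases le_expOne hα with rfl | rfl
  · rw [if_pos rfl, if_neg expOne_ne_zero.symm, add_zero]
    exact hr
  · rw [if_neg expOne_ne_zero, if_pos rfl, zero_add]

theorem one_add_mul_one_add {p : ℕ} {Δ : Coideal p} {R : Type*} [Ring R] (e e' : Fin p →₀ ℕ)
    (u u' : R) : (1 + monomial Δ e u) * (1 + monomial Δ e' u') =
      1 + monomial Δ e u + monomial Δ e' u' + monomial Δ (e + e') (u * u') := by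
  rw [← monomial_mul]
  noncomm_ring

theorem one_add_mul_mul_one_add {p : ℕ} {Δ : Coideal p} {R : Type*} [Ring R]
    {e e' : Fin p →₀ ℕ} (hm : (e + e') + (e + e') ∉ Δ) (h : (e + e') + e ∉ Δ)
    (h' : (e + e') + e' ∉ Δ) (u u' u'' : R) :
    (1 + monomial Δ (e + e') u'') * ((1 + monomial Δ e' u') * (1 + monomial Δ e u)) =
      1 + monomial Δ e u + monomial Δ e' u' + monomial Δ (e + e') (u' * u + u'') := by
  have z1 : monomial Δ (e + e') u'' * monomial Δ e' u' = 0 := by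
    rw [monomial_mul, monomial_of_notMem h']
  have z2 : monomial Δ (e + e') u'' * monomial Δ e u = 0 := by
    rw [monomial_mul, monomial_of_notMem h]
  have z3 : monomial Δ e' u' * monomial Δ e u = monomial Δ (e + e') (u' * u) := by
    rw [monomial_mul, add_comm e']
  have z4 : monomial Δ (e + e') u'' * monomial Δ (e + e') (u' * u) = 0 := by
    rw [monomial_mul, monomial_of_notMem hm]
  simp only [mul_add, add_mul, one_mul, mul_one, z1, z2, z3, z4, monomial_add]
  abel

end TPS

namespace SubstMap

variable {A : Type*} [CommRing A] {q : ℕ} {Γ : Coideal q}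

/-- The substitution map `A[[s]]_{0,1} → A[[t]]_Γ` with `s ↦ a t ^ γ`, for `γ ≠ 0`, `2γ ∉ Γ`. -/
noncomputable def ofMonomial (γ : Fin q →₀ ℕ) (h0 : γ ≠ 0) (h2 : γ + γ ∉ Γ) (a : A) :
    SubstMap A (Coideal.below expOne) Γ where
  toAlgHom :=
    { toFun := fun f => algebraMap A _ (TPS.coeff 0 f) +
        TPS.coeff expOne f • TPS.monomial Γ γ a
      map_one' := by
        rw [TPS.coeff_zero_one, TPS.coeff_one (Coideal.mem_below.2 le_rfl), if_neg expOne_ne_zero,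
          map_one, zero_smul, add_zero]
      map_mul' := fun f g => by
        have hc : TPS.monomial Γ γ a * TPS.monomial Γ γ a = 0 := by
          rw [TPS.monomial_mul, TPS.monomial_of_notMem h2]
        rw [TPS.coeff_zero_mul, TPS.coeff_expOne_mul, map_mul]
        simp only [Algebra.smul_def, map_add, map_mul]
        linear_combination (-(algebraMap A (TPS Γ A) (TPS.coeff expOne f)) *
          algebraMap A (TPS Γ A) (TPS.coeff expOne g)) * hc
      map_zero' := by simp
      map_add' := fun f g => by
        simp only [map_add, add_smul]
        abel
      commutes' := fun r => by
        rw [TPS.coeff_algebraMap (Coideal.zero_mem _),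
          TPS.coeff_algebraMap (Coideal.mem_below.2 le_rfl), if_pos rfl, if_neg expOne_ne_zero,
          zero_smul, add_zero] }
  ord_pos := fun i => by
    have hi : Finsupp.single i 1 = expOne := by rw [expOne, Subsingleton.elim i 0]
    change TPS.coeff 0 (algebraMap A (TPS Γ A) (TPS.coeff 0 _) +
      TPS.coeff expOne _ • TPS.monomial Γ γ a) = (0 : A)
    rw [hi, TPS.coeff_monomial (Coideal.zero_mem _), if_neg expOne_ne_zero.symm, map_zero, zero_add,
      TPS.coeff_smul, TPS.coeff_monomial Γ.zero_mem, if_neg h0.symm, mul_zero]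

theorem bullet_ofMonomial {R : Type*} [Ring R] (ι : A →+* R) (γ : Fin q →₀ ℕ) (h0 : γ ≠ 0)
    (h2 : γ + γ ∉ Γ) (a : A) {r : TPS (Coideal.below expOne) R} (hr : r ∈ TPS.U _ R) :
    (ofMonomial γ h0 h2 a).bullet ι r =
      1 + TPS.monomial Γ γ (ι a * TPS.coeff expOne r) := by
  classical
  have hc0 : ∀ e ∈ Γ, TPS.coeff e ((ofMonomial (Γ := Γ) γ h0 h2 a).toAlgHom
      (TPS.monomial _ 0 1)) = if e = 0 then 1 else 0 := by
    intro e he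
    have h1 : (TPS.monomial (Coideal.below expOne) 0 1 : TPS _ A) = 1 := by
      rw [TPS.monomial, MvPowerSeries.monomial_zero_one, map_one]
    rw [h1, map_one, TPS.coeff_one he]
  have hc1 : ∀ e ∈ Γ, TPS.coeff e ((ofMonomial (Γ := Γ) γ h0 h2 a).toAlgHom
      (TPS.monomial _ expOne 1)) = if e = γ then a else 0 := by
    intro e he
    change TPS.coeff e (algebraMap A _ (TPS.coeff 0 _) + TPS.coeff expOne _ • _) = _
    rw [TPS.coeff_monomial (Coideal.zero_mem _), if_neg expOne_ne_zero.symm, map_zero, zero_add,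
      TPS.coeff_smul, TPS.coeff_monomial he, TPS.coeff_monomial (Coideal.mem_below.2 le_rfl),
      if_pos rfl, one_mul]
  refine TPS.ext fun e he => ?_
  rw [coeff_bullet _ _ _ he, map_add, TPS.coeff_one he, TPS.coeff_monomial he]
  by_cases h : e = 0
  · subst h
    rw [if_pos rfl, if_neg h0.symm, add_zero, Finset.sum_eq_single 0]
    · rw [hc0 0 he, if_pos rfl, map_one, one_mul]
      exact hr
    · intro β hβ hβ0
      rw [mem_degreeLE, map_zero] at hβ
      exact absurd ((Finsupp.degree_eq_zero_iff β).1 (Nat.le_zero.1 hβ)) hβ0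
    · intro h
      exact absurd (mem_degreeLE.2 (by simp)) h
  · have hsub : ({0, expOne} : Finset (Fin 1 →₀ ℕ)) ⊆ degreeLE 1 e.degree := by
      have : e.degree ≠ 0 := fun h' => h ((Finsupp.degree_eq_zero_iff e).1 h')
      intro β hβ
      rw [Finset.mem_insert, Finset.mem_singleton] at hβ
      rw [mem_degreeLE]
      rcases hβ with rfl | rfl
      · simp
      · rw [expOne, Finsupp.degree_single]
        omega
    rw [← Finset.sum_subset hsub, Finset.sum_pair expOne_ne_zero.symm, hc0 e he, hc1 e he,
      if_neg h, map_zero, zero_mul]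
    · split_ifs <;> simp
    · intro β _ hβ
      rw [TPS.coeff_of_notMem (f := r), mul_zero]
      intro hβ'
      rw [Finset.mem_insert, Finset.mem_singleton] at hβ
      exact hβ (le_expOne hβ')

end SubstMap

section Kappa

variable {k A : Type*} [CommRing k] [CommRing A] [Algebra k A]

/-- The Hasse–Schmidt derivation `Id + δ s` of length `1`. -/
noncomputable def HS.ofDer (δ : Derivation k A A) : HS k A (Coideal.below expOne) :=
  ⟨1 + TPS.monomial _ expOne (δ : A →ₗ[k] A), by
    have c0 : TPS.coeff 0 (1 + TPS.monomial (Coideal.below expOne) expOne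
        ((δ : A →ₗ[k] A) : Module.End k A)) = 1 := by
      rw [map_add, TPS.coeff_zero_one, TPS.coeff_monomial (Coideal.zero_mem _),
        if_neg expOne_ne_zero.symm, add_zero]
    have c1 : TPS.coeff expOne (1 + TPS.monomial (Coideal.below expOne) expOne
        ((δ : A →ₗ[k] A) : Module.End k A)) = (δ : A →ₗ[k] A) := by
      rw [map_add, TPS.coeff_one (Coideal.mem_below.2 le_rfl), if_neg expOne_ne_zero,
        TPS.coeff_monomial (Coideal.mem_below.2 le_rfl), if_pos rfl, zero_add]
    refine ⟨c0, fun α hα x y => ?_⟩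
    rcases le_expOne hα with rfl | rfl
    · rw [c0]
      simp only [Finset.HasAntidiagonal.antidiagonal_zero, Finset.sum_singleton, c0,
        Module.End.one_apply]
    · rw [antidiagonal_expOne, Finset.sum_pair (by simp [expOne_ne_zero.symm]), c0, c1]
      simp [mul_comm]⟩

theorem HS.coe_ofDer (δ : Derivation k A A) :
    (HS.ofDer δ : TPS (Coideal.below expOne) (Module.End k A)) =
      1 + TPS.monomial _ expOne ((δ : A →ₗ[k] A) : Module.End k A) := rfl

theorem HS.coeff_ofDer (δ : Derivation k A A) :
    TPS.coeff expOne (HS.ofDer δ : TPS (Coideal.below expOne) (Module.End k A)) =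
      (δ : A →ₗ[k] A) := by
  rw [HS.coe_ofDer, map_add, TPS.coeff_one (Coideal.mem_below.2 le_rfl), if_neg expOne_ne_zero,
    TPS.coeff_monomial (Coideal.mem_below.2 le_rfl), if_pos rfl, zero_add]

namespace HSStructure

variable {R : Type*} [Ring R] [Algebra k R] {ι : A →ₐ[k] R}

/-- The map `∇ : Der_k(A) → R` of an HS-structure `Ψ`, given by `Ψ(Id + δ s) = 1 + ∇(δ) s`. -/
noncomputable def nabla (Ψ : HSStructure ι) (δ : Derivation k A A) : R :=
  TPS.coeff expOne (Ψ.toHom (Coideal.below expOne) (HS.ofDer δ) : TPS (Coideal.below expOne) R)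

theorem toHom_ofDer (Ψ : HSStructure ι) (δ : Derivation k A A) :
    (Ψ.toHom (Coideal.below expOne) (HS.ofDer δ) : TPS (Coideal.below expOne) R) =
      1 + TPS.monomial _ expOne (Ψ.nabla δ) :=
  TPS.eq_of_mem_U (Ψ.toHom _ _).2

theorem toHom_bullet_ofDer (Ψ : HSStructure ι) {q : ℕ} {Γ : Coideal q} (γ : Fin q →₀ ℕ)
    (h0 : γ ≠ 0) (h2 : γ + γ ∉ Γ) (a : A) (δ : Derivation k A A) :
    (Ψ.toHom Γ ((SubstMap.ofMonomial γ h0 h2 a).bulletHS (HS.ofDer δ)) : TPS Γ R) =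
      1 + TPS.monomial Γ γ (ι a * Ψ.nabla δ) := by
  rw [Ψ.subst]
  exact SubstMap.bullet_ofMonomial _ γ h0 h2 a (Ψ.toHom _ _).2

theorem coe_bulletHS_ofDer {q : ℕ} {Γ : Coideal q} (γ : Fin q →₀ ℕ)
    (h0 : γ ≠ 0) (h2 : γ + γ ∉ Γ) (a : A) (δ : Derivation k A A) :
    ((SubstMap.ofMonomial γ h0 h2 a).bulletHS (HS.ofDer δ) : TPS Γ (Module.End k A)) =
      1 + TPS.monomial Γ γ (((a • δ : Derivation k A A) : A →ₗ[k] A) : Module.End k A) := by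
  refine (SubstMap.bullet_ofMonomial _ γ h0 h2 a (HS.ofDer δ).2.1).trans ?_
  rw [HS.coeff_ofDer]
  rfl

theorem not_two_expOne_mem : expOne + expOne ∉ Coideal.below expOne := fun h => by
  have := h 0
  simp [expOne] at this

theorem isLRAdmissible_nabla (Ψ : HSStructure ι) : IsLRAdmissible ι Ψ.nabla where
  map_add δ δ' := by
    have h : HS.ofDer (δ + δ') = HS.ofDer δ * HS.ofDer δ' := by
      refine Subtype.ext ?_
      rw [Submonoid.coe_mul, HS.coe_ofDer, HS.coe_ofDer, HS.coe_ofDer, mul_add, add_mul, add_mul,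
        TPS.monomial_mul, TPS.monomial_of_notMem not_two_expOne_mem, Derivation.coe_add_linearMap,
        TPS.monomial_add]
      simp [add_assoc]
    rw [nabla, h, map_mul, Submonoid.coe_mul, TPS.coeff_expOne_mul]
    have h1 : ∀ w : TPS.U (Coideal.below expOne) R, TPS.coeff 0 (w : TPS (Coideal.below expOne) R) = 1 := fun w => w.2
    rw [h1, h1, one_mul, mul_one, add_comm]
    rfl
  map_smul a δ := by
    have h : HS.ofDer (a • δ) =
        (SubstMap.ofMonomial expOne expOne_ne_zero not_two_expOne_mem a).bulletHS (HS.ofDer δ) :=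
      Subtype.ext (coe_bulletHS_ofDer ..).symm
    rw [nabla, h, toHom_bullet_ofDer, map_add, TPS.coeff_one (Coideal.mem_below.2 le_rfl),
      if_neg expOne_ne_zero, TPS.coeff_monomial (Coideal.mem_below.2 le_rfl), if_pos rfl, zero_add]
  leibniz δ a := by
    have h := congrArg (TPS.coeff expOne) (Ψ.leibniz _ (HS.ofDer δ) a)
    rw [TPS.coeff_mul_C, TPS.coeff_expOne_mul, TPS.coeff_mapCoeff, TPS.coeff_mapCoeff,
      coeff_evalSeries, coeff_evalSeries, HS.coeff_ofDer] at h
    have h1 : ∀ w : TPS.U (Coideal.below expOne) R, TPS.coeff 0 (w : TPS (Coideal.below expOne) R) = 1 := fun w => w.2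
    have h2 : TPS.coeff 0 (HS.ofDer δ : TPS (Coideal.below expOne) (Module.End k A)) = 1 := (HS.ofDer δ).2.1
    rw [h1, h2, mul_one] at h
    exact h
  map_lie δ δ' := by
    let e : Fin 2 →₀ ℕ := Finsupp.single 0 1
    let e' : Fin 2 →₀ ℕ := Finsupp.single 1 1
    have he : e ≠ 0 := by simp [e]
    have he' : e' ≠ 0 := by simp [e']
    have hm : e + e' ≠ 0 := by simp [e, e']
    have n00 : e + e ∉ Coideal.below (e + e') := fun h => by
      have := h 0
      simp [e, e'] at this
    have n11 : e' + e' ∉ Coideal.below (e + e') := fun h => by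
      have := h 1
      simp [e, e'] at this
    have nmm : (e + e') + (e + e') ∉ Coideal.below (e + e') := fun h => by
      have := h 0
      simp [e, e'] at this
    have nm0 : (e + e') + e ∉ Coideal.below (e + e') := fun h => by
      have := h 0
      simp [e, e'] at this
    have nm1 : (e + e') + e' ∉ Coideal.below (e + e') := fun h => by
      have := h 1
      simp [e, e'] at this
    have key : (SubstMap.ofMonomial e he n00 (1 : A)).bulletHS (HS.ofDer δ) *
          (SubstMap.ofMonomial e' he' n11 (1 : A)).bulletHS (HS.ofDer δ') =
        (SubstMap.ofMonomial (e + e') hm nmm (1 : A)).bulletHS (HS.ofDer ⁅δ, δ'⁆) *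
          ((SubstMap.ofMonomial e' he' n11 (1 : A)).bulletHS (HS.ofDer δ') *
          (SubstMap.ofMonomial e he n00 (1 : A)).bulletHS (HS.ofDer δ)) := by
      refine Subtype.ext ?_
      simp only [Submonoid.coe_mul]
      rw [coe_bulletHS_ofDer, coe_bulletHS_ofDer, coe_bulletHS_ofDer, TPS.one_add_mul_one_add,
        TPS.one_add_mul_mul_one_add nmm nm0 nm1]
      congr 2
      refine LinearMap.ext fun x => ?_
      simp only [one_smul]
      change δ (δ' x) = δ' (δ x) + ⁅δ, δ'⁆ x
      rw [Derivation.commutator_apply]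
      abel
    have h := congrArg (fun w => (Ψ.toHom _ w : TPS (Coideal.below (e + e')) R)) key
    simp only [map_mul, Submonoid.coe_mul, toHom_bullet_ofDer, map_one, one_mul] at h
    rw [TPS.one_add_mul_one_add, TPS.one_add_mul_mul_one_add nmm nm0 nm1] at h
    have h' := congrArg (TPS.coeff (e + e')) (add_left_cancel h)
    rw [TPS.coeff_monomial (Coideal.mem_below.2 le_rfl),
      TPS.coeff_monomial (Coideal.mem_below.2 le_rfl), if_pos rfl, if_pos rfl] at h'
    rw [h', add_sub_cancel_left]

end HSStructure

variable (k A)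

/-- The canonical map `κ : U^LR → U^HS`: the map of `k`-algebras over `A` induced by the
LR-admissible map of the universal HS-structure. -/
noncomputable def kappa : ULR k A →ₐ[k] UHS k A :=
  ULR.lift (UHS.univ k A).isLRAdmissible_nabla

theorem kappa_ι (a : A) : kappa k A (ULR.ι k A a) = UHS.ι k A a := ULR.lift_ι _ a

theorem kappa_σ (δ : Derivation k A A) : kappa k A (ULR.σ k A δ) = (UHS.univ k A).nabla δ :=
  ULR.lift_σ _ δ

end Kappa

/-! Let `χ` be the Euler derivation `s ^ α ↦ |α| s ^ α` of a truncated power series ring. Since the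
positive integers are invertible in `k`, an equation `χ(Y) = l Y` with `l_0 = 0` has exactly one
solution with `Y_0 = 1`, given by recursion on `|α|`. For a Hasse–Schmidt derivation `D`, the
logarithmic derivative `ε = χ(D) D⁻¹` has derivations as coefficients
(`HS.exists_euler_eq_derivation_mul`). So `D` is equivalent to the family `ε`, and this family can
be carried to any algebra that receives `Der_k(A)`.

Injectivity of `κ`: an LR-admissible map `∇` into `R` has to extend to an HS-structure, and the
natural value at `D` is the solution of `χ(Y) = ∇(ε) Y`. Products and substitutions act on `ε` by
complicated formulas. To avoid them, the equation is solved in `R × End_k(A)`, with `l` in the graph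
`L` of `∇`. The solutions are called flows. A flow is determined by its second component
(`IsLRAdmissible.flow_unique`), because the projection `L → End_k(A)` is injective; the flow over
`D` has first component `Ψ(D)`. The axioms of an HS-structure then reduce to stability of flows
under products (`IsFlow.mul`), under substitution maps (`IsFlow.bullet`, the hard part), and to `Y a
Y⁻¹` having coefficients in `A` (`IsFlow.conj`). Applied to `σ`, this gives a map `U^HS → U^LR` that
is a left inverse of `κ`.

Surjectivity and filtrations: every HS-structure `Ψ` satisfies `χ(Ψ(D)) = ∇(ε) Ψ(D)`
(`HSStructure.euler_toHom`). Indeed, with a new variable `τ`, `τ² = 0`, the equation `χ(D) = ε D`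
becomes `D(s(1 + τ)) = (1 + τ ε) D(s)`, which involves only products and substitution maps, and `Ψ`
respects both. The coefficient at `α` reads `|α| Υ(D)_α = ∑ ∇(ε_β) Υ(D)_γ` over `β + γ = α`, `β ≠
0`; by induction `Υ(D)_α` lies in the image of the step `|α|` of `U^LR` (`comp_mem_map_fil`). -/

/-! ### Division by integers, and sums over antidiagonals. -/

/-- Over a `ℚ`-algebra `k`, a submodule contains `x` as soon as it contains `n • x`, `n ≠ 0`. -/
theorem Submodule.mem_of_nsmul_mem_of_rat {k M : Type*} [CommRing k] [Algebra ℚ k] [AddCommGroup M]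
    [Module k M] (S : Submodule k M) {n : ℕ} (hn : n ≠ 0) {x : M} (h : n • x ∈ S) : x ∈ S := by
  have hx : x = algebraMap ℚ k (n : ℚ)⁻¹ • (n • x) := by
    rw [← Nat.cast_smul_eq_nsmul k, smul_smul, ← map_natCast (algebraMap ℚ k), ← map_mul,
      inv_mul_cancel₀ (Nat.cast_ne_zero.2 hn), map_one, one_smul]
  rw [hx]
  exact S.smul_mem _ h

theorem Finsupp.degree_snd_lt_of_mem_antidiagonal {p : ℕ} {α : Fin p →₀ ℕ}
    {x : (Fin p →₀ ℕ) × (Fin p →₀ ℕ)} (hx : x ∈ Finset.HasAntidiagonal.antidiagonal α)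
    (h : x.1 ≠ 0) : x.2.degree < α.degree := by
  rw [← Finset.HasAntidiagonal.mem_antidiagonal.1 hx, map_add]
  have : x.1.degree ≠ 0 := fun h' => h ((Finsupp.degree_eq_zero_iff _).1 h')
  omega

theorem Finsupp.degree_fst_lt_of_mem_antidiagonal {p : ℕ} {α : Fin p →₀ ℕ}
    {x : (Fin p →₀ ℕ) × (Fin p →₀ ℕ)} (hx : x ∈ Finset.HasAntidiagonal.antidiagonal α)
    (h : x.2 ≠ 0) : x.1.degree < α.degree := by
  rw [← Finset.HasAntidiagonal.mem_antidiagonal.1 hx, map_add]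
  have : x.2.degree ≠ 0 := fun h' => h ((Finsupp.degree_eq_zero_iff _).1 h')
  omega

/-- Both sides run over the triples with sum `α`; the right side singles out the middle entry. -/
theorem Finset.sum_antidiagonal_swap_inner {X M : Type*} [AddCommMonoid X]
    [Finset.HasAntidiagonal X] [AddCommMonoid M] (F : X → X → X → M) (α : X) :
    ∑ z ∈ Finset.HasAntidiagonal.antidiagonal α,
      ∑ u ∈ Finset.HasAntidiagonal.antidiagonal z.1, F u.1 u.2 z.2 =
    ∑ z ∈ Finset.HasAntidiagonal.antidiagonal α,
      ∑ u ∈ Finset.HasAntidiagonal.antidiagonal z.2, F u.1 z.1 u.2 := by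
  simp_rw [Finset.sum_sigma']
  refine Finset.sum_nbij'
    (fun x => ⟨(x.2.2, x.2.1 + x.1.2), (x.2.1, x.1.2)⟩)
    (fun x => ⟨(x.2.1 + x.1.1, x.2.2), (x.2.1, x.1.1)⟩) ?_ ?_ ?_ ?_ ?_
  · rintro ⟨⟨a, b⟩, ⟨c, d⟩⟩ h
    simp only [Finset.mem_sigma, Finset.HasAntidiagonal.mem_antidiagonal] at h ⊢
    obtain ⟨rfl, rfl⟩ := h
    exact ⟨by abel, trivial⟩
  · rintro ⟨⟨a, b⟩, ⟨c, d⟩⟩ h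
    simp only [Finset.mem_sigma, Finset.HasAntidiagonal.mem_antidiagonal] at h ⊢
    obtain ⟨rfl, rfl⟩ := h
    exact ⟨by abel, trivial⟩
  · rintro ⟨⟨a, b⟩, ⟨c, d⟩⟩ h
    simp only [Finset.mem_sigma, Finset.HasAntidiagonal.mem_antidiagonal] at h ⊢
    obtain ⟨rfl, rfl⟩ := h
    rfl
  · rintro ⟨⟨a, b⟩, ⟨c, d⟩⟩ h
    simp only [Finset.mem_sigma, Finset.HasAntidiagonal.mem_antidiagonal] at h ⊢
    obtain ⟨rfl, rfl⟩ := h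
    rfl
  · rintro ⟨⟨a, b⟩, ⟨c, d⟩⟩ h
    rfl

/-- The co-ideal `ℕ^p`. -/
def Coideal.full (p : ℕ) : Coideal p where
  carrier := Set.univ
  nonempty' := ⟨0, trivial⟩
  lower' := fun _ _ _ _ => trivial

theorem Coideal.mem_full {p : ℕ} (α : Fin p →₀ ℕ) : α ∈ Coideal.full p := trivial

/-! ### Euler derivations and partial derivatives of truncated power series. -/

namespace TPS

variable {p : ℕ} {Δ : Coideal p} {R : Type*} [Ring R]

theorem ext' {f g : TPS Δ R} (h : ∀ α, coeff α f = coeff α g) : f = g := ext fun α _ => h α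

theorem coeff_C {α : Fin p →₀ ℕ} (hα : α ∈ Δ) (a : R) :
    coeff α (C Δ a) = if α = 0 then a else 0 := by
  classical
  rw [C, coeff_mk hα, MvPowerSeries.coeff_C]

theorem monomial_zero_eq_C (a : R) : monomial Δ 0 a = C Δ a :=
  ext fun α hα => by rw [coeff_monomial hα, coeff_C hα]

theorem C_mul (a b : R) : C Δ (a * b) = C Δ a * C Δ b := by
  rw [C, C, C, ← map_mul, map_mul]

theorem coeff_add_single_monomial_mul {p : ℕ} (β α : Fin p →₀ ℕ)
    (f : TPS (Coideal.full p) R) :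
    coeff (β + α) (monomial (Coideal.full p) β 1 * f) = coeff α f := by
  obtain ⟨f, rfl⟩ := Ideal.Quotient.mk_surjective f
  rw [monomial, ← map_mul, coeff_mk (Coideal.mem_full _), coeff_mk (Coideal.mem_full _),
    MvPowerSeries.coeff_add_monomial_mul, one_mul]

/-- Over the full co-ideal multiplication by `s ^ β` only shifts coefficients and loses none, so it
can be cancelled. Rules for `pderiv` are thereby deduced from those for `euler`. -/
theorem monomial_one_mul_injective {p : ℕ} (β : Fin p →₀ ℕ) {f g : TPS (Coideal.full p) R}
    (h : monomial (Coideal.full p) β 1 * f = monomial (Coideal.full p) β 1 * g) : f = g :=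
  ext' fun α => by
    rw [← coeff_add_single_monomial_mul β α f, h, coeff_add_single_monomial_mul]

theorem commute_monomial_one (β : Fin p →₀ ℕ) (f : TPS Δ R) : Commute (monomial Δ β 1) f := by
  obtain ⟨f, rfl⟩ := Ideal.Quotient.mk_surjective f
  rw [Commute, SemiconjBy, monomial, ← map_mul, ← map_mul,
    (MvPowerSeries.commute_monomial (φ := f) (a := (1 : R)) (n := β)).2 fun m => by simp]

theorem coeff_mul_sub_mul {α : Fin p →₀ ℕ} (hα : α ∈ Δ) (f g : TPS Δ R) :
    coeff α (f * g - g * f) = ∑ x ∈ Finset.HasAntidiagonal.antidiagonal α,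
      (coeff x.1 f * coeff x.2 g - coeff x.2 g * coeff x.1 f) := by
  rw [map_sub, coeff_mul hα, coeff_mul hα, Finset.sum_sub_distrib]
  congr 1
  exact Finset.sum_equiv (Equiv.prodComm _ _) (by simp [add_comm]) (by simp)

/-- The variables are central, so the middle factor can be expanded into its coefficients. This
reduces statements on `f m g` to constant `m`. -/
theorem coeff_mul_mul {α : Fin p →₀ ℕ} (hα : α ∈ Δ) (f m g : TPS Δ R) :
    coeff α (f * m * g) = ∑ x ∈ Finset.HasAntidiagonal.antidiagonal α,
      coeff x.2 (f * C Δ (coeff x.1 m) * g) := by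
  rw [coeff_mul hα]
  trans ∑ z ∈ Finset.HasAntidiagonal.antidiagonal α,
      ∑ u ∈ Finset.HasAntidiagonal.antidiagonal z.1, coeff u.1 f * coeff u.2 m * coeff z.2 g
  · refine Finset.sum_congr rfl fun z hz => ?_
    rw [coeff_mul (Δ.fst_mem hα hz), Finset.sum_mul]
  · rw [Finset.sum_antidiagonal_swap_inner fun a b c => coeff a f * coeff b m * coeff c g]
    refine Finset.sum_congr rfl fun z hz => ?_
    rw [coeff_mul (Δ.snd_mem hα hz)]
    simp only [coeff_mul_C]

/-- The derivation of `R[[s]]_Δ` with `s ^ α ↦ w(α) s ^ α`, for an additive weight `w`. -/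
noncomputable def euler (w : (Fin p →₀ ℕ) →+ ℕ) : TPS Δ R →+ TPS Δ R where
  toFun f := ofFun Δ fun α => w α • coeff α f
  map_zero' := ext fun α hα => by rw [coeff_ofFun hα, map_zero, smul_zero]
  map_add' f g := ext fun α hα => by
    rw [coeff_ofFun hα, map_add, map_add, coeff_ofFun hα, coeff_ofFun hα, smul_add]

variable (w : (Fin p →₀ ℕ) →+ ℕ)

theorem coeff_euler (f : TPS Δ R) (α : Fin p →₀ ℕ) : coeff α (euler w f) = w α • coeff α f := by
  by_cases hα : α ∈ Δ
  · exact coeff_ofFun hα _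
  · rw [coeff_of_notMem hα, coeff_of_notMem hα, smul_zero]

theorem euler_mul (f g : TPS Δ R) : euler w (f * g) = euler w f * g + f * euler w g := by
  refine ext fun α hα => ?_
  rw [coeff_euler, map_add, coeff_mul hα, coeff_mul hα, coeff_mul hα, Finset.smul_sum,
    ← Finset.sum_add_distrib]
  refine Finset.sum_congr rfl fun x hx => ?_
  rw [coeff_euler, coeff_euler, ← Finset.HasAntidiagonal.mem_antidiagonal.1 hx, map_add, add_smul,
    smul_mul_assoc, mul_smul_comm]

theorem euler_C (a : R) : euler w (C Δ a) = 0 := ext fun α hα => by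
  rw [coeff_euler, coeff_C hα, map_zero]
  split_ifs with h
  · rw [h, map_zero, zero_smul]
  · rw [smul_zero]

theorem euler_one : euler w (1 : TPS Δ R) = 0 := by
  rw [← euler_C w (1 : R)]
  rfl

/-- Application of a ring homomorphism to all coefficients. -/
noncomputable def mapRingHom {R' : Type*} [Ring R'] (f : R →+* R') : TPS Δ R →+* TPS Δ R' where
  toFun := mapCoeff (f : R →+ R')
  map_zero' := ext' fun α => by rw [coeff_mapCoeff]; simp
  map_add' r r' := ext' fun α => by
    rw [map_add, coeff_mapCoeff, coeff_mapCoeff, coeff_mapCoeff, map_add, map_add]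
  map_one' := ext fun α hα => by
    rw [coeff_mapCoeff, coeff_one hα, coeff_one hα]
    split_ifs <;> simp
  map_mul' r r' := ext fun α hα => by
    rw [coeff_mapCoeff, coeff_mul hα, coeff_mul hα, map_sum]
    refine Finset.sum_congr rfl fun x _ => ?_
    rw [coeff_mapCoeff, coeff_mapCoeff]
    exact map_mul f _ _

variable {R' : Type*} [Ring R']

theorem coeff_mapRingHom (f : R →+* R') (r : TPS Δ R) (α : Fin p →₀ ℕ) :
    coeff α (mapRingHom f r) = f (coeff α r) := coeff_mapCoeff _ _ _

theorem mapRingHom_C (f : R →+* R') (a : R) : mapRingHom f (C Δ a) = C Δ (f a) :=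
  ext fun α hα => by rw [coeff_mapRingHom, coeff_C hα, coeff_C hα]; split_ifs <;> simp

theorem euler_mapRingHom (f : R →+* R') (r : TPS Δ R) :
    euler w (mapRingHom f r) = mapRingHom f (euler w r) :=
  ext' fun α => by rw [coeff_euler, coeff_mapRingHom, coeff_mapRingHom, coeff_euler, map_nsmul]

theorem exists_mapRingHom_eq {f : R →+* R'} {r : TPS Δ R'} (h : ∀ α, ∃ a, coeff α r = f a) :
    ∃ g : TPS Δ R, r = mapRingHom f g := by
  choose a ha using h
  exact ⟨ofFun Δ a, ext fun α hα => by rw [coeff_mapRingHom, coeff_ofFun hα, ha]⟩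

theorem mapRingHom_injective {f : R →+* R'} (hf : Function.Injective f) :
    Function.Injective (mapRingHom (Δ := Δ) f) := fun r r' h => ext' fun α => hf <| by
  rw [← coeff_mapRingHom, h, coeff_mapRingHom]

/-- The partial derivative of a power series. -/
noncomputable def pderiv (i : Fin p) : TPS (Coideal.full p) R →+ TPS (Coideal.full p) R where
  toFun f := ofFun _ fun α => (α i + 1) • coeff (α + Finsupp.single i 1) f
  map_zero' := ext fun α hα => by rw [coeff_ofFun hα, map_zero, map_zero, smul_zero]
  map_add' f g := ext fun α hα => by
    rw [coeff_ofFun hα, map_add, map_add, coeff_ofFun hα, coeff_ofFun hα, smul_add]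

theorem coeff_pderiv (i : Fin p) (f : TPS (Coideal.full p) R) (α : Fin p →₀ ℕ) :
    coeff α (pderiv i f) = (α i + 1) • coeff (α + Finsupp.single i 1) f :=
  coeff_ofFun (Coideal.mem_full _) _

theorem monomial_mul_pderiv (i : Fin p) (f : TPS (Coideal.full p) R) :
    monomial _ (Finsupp.single i 1) 1 * pderiv i f = euler (Finsupp.applyAddHom i) f := by
  refine ext' fun α => ?_
  rw [coeff_euler, Finsupp.applyAddHom_apply]
  by_cases h : α i = 0
  · rw [h, zero_smul, coeff_mul (Coideal.mem_full _)]
    refine Finset.sum_eq_zero fun x hx => ?_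
    rw [coeff_monomial (Coideal.mem_full _), if_neg, zero_mul]
    intro h1
    have := DFunLike.congr_fun (Finset.HasAntidiagonal.mem_antidiagonal.1 hx) i
    rw [h1, h] at this
    simp at this
  · have hle : Finsupp.single i 1 ≤ α := Finsupp.single_le_iff.2 (Nat.one_le_iff_ne_zero.2 h)
    obtain ⟨β, rfl⟩ := exists_add_of_le hle
    rw [coeff_add_single_monomial_mul, coeff_pderiv, add_comm β]
    congr 1
    simp [add_comm]

/-- After multiplication by `s_i` this is the product rule for the Euler derivation of weight `α ↦ α
i`. -/
theorem pderiv_mul (i : Fin p) (f g : TPS (Coideal.full p) R) :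
    pderiv i (f * g) = pderiv i f * g + f * pderiv i g := by
  refine monomial_one_mul_injective (Finsupp.single i 1) ?_
  rw [monomial_mul_pderiv, euler_mul, mul_add, ← mul_assoc, monomial_mul_pderiv, ← mul_assoc,
    (commute_monomial_one _ f).eq, mul_assoc, monomial_mul_pderiv]

/-- A partial derivative lowers the degree by one, whence the commutator `[∂_i, χ] = ∂_i`. -/
theorem pderiv_euler_degree (i : Fin p) (f : TPS (Coideal.full p) R) :
    pderiv i (euler Finsupp.degree f) = euler Finsupp.degree (pderiv i f) + pderiv i f := by
  refine ext' fun α => ?_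
  rw [map_add, coeff_pderiv, coeff_euler, coeff_euler, coeff_pderiv, map_add, Finsupp.degree_single,
    smul_smul, smul_smul, ← add_smul]
  congr 1
  ring

theorem pderiv_monomial (i : Fin p) (β : Fin p →₀ ℕ) (r : R) :
    pderiv i (monomial _ β r) = β i • monomial (Coideal.full p) (β - Finsupp.single i 1) r := by
  refine ext' fun α => ?_
  rw [coeff_pderiv, map_nsmul, coeff_monomial (Coideal.mem_full _),
    coeff_monomial (Coideal.mem_full _)]
  by_cases h : β i = 0
  · rw [h, zero_smul, if_neg, smul_zero]
    rintro rfl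
    simp at h
  · have hle : Finsupp.single i 1 ≤ β := Finsupp.single_le_iff.2 (Nat.one_le_iff_ne_zero.2 h)
    obtain ⟨γ, rfl⟩ := exists_add_of_le hle
    rw [add_tsub_cancel_left, add_comm (Finsupp.single i 1) γ]
    simp only [add_left_inj]
    split_ifs with h1
    · rw [h1]; simp
    · simp

/-- Density of polynomials: an additive map that sees only the coefficients of degree at most `N` is
determined by its values on monomials. Identities between maps that are merely additive are checked
on monomials in this way, one output coefficient at a time. -/
theorem eq_zero_of_monomial {M : Type*} [AddCommMonoid M] (F : TPS Δ R →+ M) (N : ℕ)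
    (hF : ∀ f, (∀ β, β.degree ≤ N → coeff β f = 0) → F f = 0)
    (hm : ∀ β r, F (monomial Δ β r) = 0) (f : TPS Δ R) : F f = 0 := by
  classical
  have h : f = (f - ∑ β ∈ degreeLE p N, monomial Δ β (coeff β f)) +
    ∑ β ∈ degreeLE p N, monomial Δ β (coeff β f) := by abel
  rw [h, map_add, map_sum, Finset.sum_eq_zero fun β _ => hm β _, add_zero]
  refine hF _ fun β hβ => ?_
  by_cases hβ' : β ∈ Δ
  · rw [map_sub, map_sum]
    simp only [coeff_monomial hβ', Finset.sum_ite_eq, mem_degreeLE, hβ, if_true, sub_self]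
  · exact coeff_of_notMem hβ' _

end TPS

/-! ### The differential equation `χ(Y) = l Y`. -/

namespace TPS

section Solution

variable {p : ℕ} {Δ : Coideal p}

/-- The coefficients of the solution `Y` of `χ(Y) = l Y`, `Y_0 = 1`, where `χ(s ^ α) = |α| s ^ α`. -/
noncomputable def solutionCoeff (k : Type*) {R : Type*} [CommRing k] [Algebra ℚ k] [Ring R]
    [Algebra k R] (l : (Fin p →₀ ℕ) → R) (α : Fin p →₀ ℕ) : R :=
  if α = 0 then 1 else algebraMap ℚ k (α.degree : ℚ)⁻¹ •
    ∑ x ∈ (Finset.HasAntidiagonal.antidiagonal α).attach,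
      -- The term of index `(0, α)` is cut off to make the recursion well-founded; it vanishes
      -- anyway when `l_0 = 0`.
      if _h : x.1.1 = 0 then 0 else l x.1.1 * solutionCoeff k l x.1.2
  termination_by α.degree
  decreasing_by exact Finsupp.degree_snd_lt_of_mem_antidiagonal x.2 _h

theorem exists_euler_eq_mul (k : Type*) {R : Type*} [CommRing k] [Algebra ℚ k] [Ring R]
    [Algebra k R] (l : TPS Δ R) (hl : coeff 0 l = 0) :
    ∃ Y : TPS Δ R, coeff 0 Y = 1 ∧ euler Finsupp.degree Y = l * Y := by
  refine ⟨ofFun Δ (solutionCoeff k fun α => coeff α l), ?_, ext fun α hα => ?_⟩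
  · rw [coeff_ofFun Δ.zero_mem, solutionCoeff, if_pos rfl]
  rw [coeff_euler, coeff_ofFun hα, coeff_mul hα]
  by_cases h : α = 0
  · subst h
    simp [hl]
  have hd : (α.degree : ℚ) ≠ 0 :=
    Nat.cast_ne_zero.2 fun h' => h ((Finsupp.degree_eq_zero_iff _).1 h')
  rw [solutionCoeff, if_neg h, ← Nat.cast_smul_eq_nsmul k, smul_smul, ← map_natCast (algebraMap ℚ k),
    ← map_mul, mul_inv_cancel₀ hd, map_one, one_smul]
  simp only [dite_eq_ite]
  rw [Finset.sum_attach (Finset.HasAntidiagonal.antidiagonal α) fun x =>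
      if x.1 = 0 then 0 else coeff x.1 l * solutionCoeff k (fun α => coeff α l) x.2]
  refine Finset.sum_congr rfl fun x hx => ?_
  rw [coeff_ofFun (Δ.snd_mem hα hx)]
  split_ifs with h
  · rw [h, hl, zero_mul]
  · rfl

/-- If `l_0` vanishes, the coefficients of `X` are in `S` as soon as those of
`(χ + c)(X) - (l X - X l)` are, provided that `S` is stable under the brackets with all `l_α`. -/
theorem coeff_mem_of_euler_sub_lie {k R : Type*} [CommRing k] [Algebra ℚ k] [Ring R]
    [Algebra k R] {S : Submodule k R} {l X F : TPS Δ R} (hl : coeff 0 l = 0)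
    (hS : ∀ α, ∀ s ∈ S, coeff α l * s - s * coeff α l ∈ S) (hF : ∀ α, coeff α F ∈ S) (c : ℕ)
    (h0 : c = 0 → coeff 0 X ∈ S)
    (h : euler Finsupp.degree X + c • X = F + (l * X - X * l)) (α : Fin p →₀ ℕ) :
    coeff α X ∈ S := by
  by_cases hα : α ∈ Δ
  swap
  · rw [coeff_of_notMem hα]; exact S.zero_mem
  induction hn : α.degree using Nat.strong_induction_on generalizing α with
  | _ n ih =>
    -- The coefficient of the left side at `α` is `(|α| + c) X_α`, so `|α| + c` must be divided by;
    -- it vanishes only for `α = 0`, `c = 0`, where the initial condition `h0` takes over.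
    by_cases hc : n + c = 0
    · have h1 : α = 0 := (Finsupp.degree_eq_zero_iff _).1 (by omega)
      rw [h1]
      exact h0 (by omega)
    refine S.mem_of_nsmul_mem_of_rat hc ?_
    have := congrArg (coeff α) h
    rw [map_add, map_add, map_nsmul, coeff_euler, hn, ← add_smul, coeff_mul_sub_mul hα] at this
    rw [this]
    refine S.add_mem (hF α) (S.sum_mem fun x hx => ?_)
    by_cases hx0 : x.1 = 0
    · rw [hx0, hl, zero_mul, mul_zero, sub_zero]
      exact S.zero_mem
    · exact hS _ _ (ih _ (hn ▸ Finsupp.degree_snd_lt_of_mem_antidiagonal hx hx0) _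
        (Δ.snd_mem hα hx) rfl)

/-- As `l_0 = 0`, the equation expresses `|α| Y_α` through coefficients of smaller degree, and `|α|`
is invertible. -/
theorem eq_of_euler_eq_mul (k : Type*) {R : Type*} [CommRing k] [Algebra ℚ k] [Ring R]
    [Algebra k R] {l Y Y' : TPS Δ R} (hl : coeff 0 l = 0) (h0 : coeff 0 Y = coeff 0 Y')
    (h : euler Finsupp.degree Y = l * Y) (h' : euler Finsupp.degree Y' = l * Y') : Y = Y' := by
  refine ext fun α hα => ?_
  induction hn : α.degree using Nat.strong_induction_on generalizing α with
  | _ n ih =>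
    by_cases hc : n = 0
    · rw [(Finsupp.degree_eq_zero_iff _).1 (hn.trans hc), h0]
    rw [← sub_eq_zero, ← Submodule.mem_bot k]
    refine Submodule.mem_of_nsmul_mem_of_rat ⊥ hc ?_
    have e := congrArg (coeff α) h
    have e' := congrArg (coeff α) h'
    rw [coeff_euler, hn, coeff_mul hα] at e e'
    rw [Submodule.mem_bot, smul_sub, e, e', sub_eq_zero]
    refine Finset.sum_congr rfl fun x hx => ?_
    by_cases hx0 : x.1 = 0
    · rw [hx0, hl, zero_mul, zero_mul]
    · rw [ih _ (hn ▸ Finsupp.degree_snd_lt_of_mem_antidiagonal hx hx0) _ (Δ.snd_mem hα hx) rfl]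

end Solution

end TPS

/-! ### Flows of a Lie–Rinehart submodule. -/

/-- A submodule `L` of a `k`-algebra `R` over `A` is a Lie–Rinehart subalgebra if it is stable under
left multiplication by `A` and under brackets, and its brackets with `A` are in `A`. -/
structure IsLRSubmodule {k A R : Type*} [CommRing k] [CommRing A] [Algebra k A] [Ring R]
    [Algebra k R] (ι : A →ₐ[k] R) (L : Submodule k R) : Prop where
  smul_mem : ∀ (a : A), ∀ l ∈ L, ι a * l ∈ L
  lie_mem : ∀ l ∈ L, ∀ l' ∈ L, l * l' - l' * l ∈ L
  lie_ι : ∀ l ∈ L, ∀ a, ∃ b, l * ι a - ι a * l = ι b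

namespace TPS

/-- The series `Y` with constant coefficient `1` and `χ(Y) Y⁻¹ ∈ L[[s]]_Δ`. -/
def IsFlow {k R : Type*} [CommRing k] [Ring R] [Algebra k R] (L : Submodule k R) {p : ℕ}
    {Δ : Coideal p} (Y : TPS Δ R) : Prop :=
  coeff 0 Y = 1 ∧ ∃ l : TPS Δ R, (∀ α, coeff α l ∈ L) ∧ euler Finsupp.degree Y = l * Y

section Flow

variable {k A R : Type*} [CommRing k] [CommRing A] [Algebra k A] [Ring R]
  [Algebra k R] {ι : A →ₐ[k] R} {L : Submodule k R} {p : ℕ} {Δ : Coideal p}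

theorem coeff_zero_eq_zero_of_euler_eq_mul {l Y : TPS Δ R} (h0 : coeff 0 Y = 1)
    (h : euler Finsupp.degree Y = l * Y) : coeff 0 l = 0 := by
  have := congrArg (coeff 0) h
  rw [coeff_euler, map_zero, zero_smul, coeff_zero_mul, h0, mul_one] at this
  exact this.symm

theorem exists_inverse {Y : TPS Δ R} (h0 : coeff 0 Y = 1) : ∃ Z : TPS Δ R, Y * Z = 1 ∧ Z * Y = 1 := by
  obtain ⟨u, rfl⟩ := isUnit_of_mem_U (r := Y) h0
  exact ⟨_, u.mul_inv, u.inv_mul⟩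

/-- The derivative of `Y m Y⁻¹`. -/
theorem euler_conj {l Y Z : TPS Δ R} (hZ : Y * Z = 1) (hZ' : Z * Y = 1)
    (h : euler Finsupp.degree Y = l * Y) (m : TPS Δ R) :
    euler Finsupp.degree (Y * m * Z) =
      Y * euler Finsupp.degree m * Z + (l * (Y * m * Z) - Y * m * Z * l) := by
  -- The derivative of the inverse, from `χ(Z Y) = 0`.
  have h1 : euler Finsupp.degree Z = - (Z * l) := by
    have h2 := euler_mul Finsupp.degree Z Y
    rw [hZ', euler_one, h] at h2
    calc euler Finsupp.degree Z = euler Finsupp.degree Z * Y * Z := by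
          rw [mul_assoc, hZ, mul_one]
      _ = (euler Finsupp.degree Z * Y + Z * (l * Y)) * Z - Z * l * (Y * Z) := by noncomm_ring
      _ = _ := by rw [← h2, hZ]; noncomm_ring
  rw [euler_mul, euler_mul, h, h1]
  noncomm_ring

theorem isFlow_one : IsFlow L (1 : TPS Δ R) :=
  ⟨coeff_zero_one, 0, fun α => by rw [map_zero]; exact L.zero_mem, by rw [euler_one, zero_mul]⟩

variable [Algebra ℚ k]

/-- Conjugation by a flow integrates the brackets with `L`: the series `X = Y s Y⁻¹`, for constant
`s`, solves `χ(X) = [l, X]` with `X_0 = s`, so its coefficients stay in any submodule stable under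
these brackets. It is used with `S = L` and with `S` the image of `A`. -/
theorem IsFlow.conj {Y Z : TPS Δ R} (hY : IsFlow L Y) (hZ : Y * Z = 1) {S : Submodule k R}
    (hS : ∀ l ∈ L, ∀ s ∈ S, l * s - s * l ∈ S) {m : TPS Δ R} (hm : ∀ α, coeff α m ∈ S)
    (α : Fin p →₀ ℕ) : coeff α (Y * m * Z) ∈ S := by
  obtain ⟨h0, l, hl, h⟩ := hY
  have hZ' : Z * Y = 1 := by
    obtain ⟨Z', h1, h2⟩ := exists_inverse h0
    have : Z = Z' := by rw [← one_mul Z, ← h2, mul_assoc, hZ, mul_one]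
    rw [this, h2]
  have hC : ∀ s ∈ S, ∀ α, coeff α (Y * C Δ s * Z) ∈ S := by
    intro s hs
    refine coeff_mem_of_euler_sub_lie (coeff_zero_eq_zero_of_euler_eq_mul h0 h)
      (fun α => hS _ (hl α)) (F := 0) (fun α => by rw [map_zero]; exact S.zero_mem) 0 ?_ ?_
    · intro _
      have hz : coeff 0 Z = 1 := by
        have := congrArg (coeff 0) hZ
        rwa [coeff_zero_mul, h0, one_mul, coeff_zero_one] at this
      rw [coeff_zero_mul, coeff_mul_C, h0, hz, one_mul, mul_one]
      exact hs
    · rw [euler_conj hZ hZ' h, euler_C]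
      simp
  by_cases hα : α ∈ Δ
  · rw [coeff_mul_mul hα]
    exact S.sum_mem fun x _ => hC _ (hm _) _
  · rw [coeff_of_notMem hα]
    exact S.zero_mem

/-- The logarithmic derivative of `Y Y'` is `l + Y l' Y⁻¹`, and conjugation by `Y` preserves the
series with coefficients in `L`. -/
theorem IsFlow.mul (hL : IsLRSubmodule ι L) {Y Y' : TPS Δ R} (hY : IsFlow L Y)
    (hY' : IsFlow L Y') : IsFlow L (Y * Y') := by
  obtain ⟨h0', l', hl', h'⟩ := hY'
  obtain ⟨Z, hZ, hZ'⟩ := exists_inverse hY.1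
  have hc := hY.conj hZ hL.lie_mem hl'
  obtain ⟨h0, l, hl, h⟩ := hY
  refine ⟨by rw [coeff_zero_mul, h0, h0', one_mul], l + Y * l' * Z, fun α => ?_, ?_⟩
  · rw [map_add]
    exact L.add_mem (hl α) (hc α)
  · rw [euler_mul, h, h', add_mul, mul_assoc (Y * l'), ← mul_assoc Z, hZ', one_mul]
    noncomm_ring

/-- Partial derivatives do not descend to `R[[s]]_Δ`, so flows are first lifted to `R[[s]]`: extend
`l` by zero outside `Δ` and solve the equation again. By uniqueness the truncation of the solution
is `Y`. -/
theorem IsFlow.exists_lift {Y : TPS Δ R} (hY : IsFlow L Y) :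
    ∃ Y' : TPS (Coideal.full p) R, IsFlow L Y' ∧ ∀ α ∈ Δ, coeff α Y' = coeff α Y := by
  obtain ⟨h0, l, hl, h⟩ := hY
  have hl0 := coeff_zero_eq_zero_of_euler_eq_mul h0 h
  have hc : ∀ α, coeff α (ofFun (Coideal.full p) fun α => coeff α l) = coeff α l := fun α =>
    coeff_ofFun (Coideal.mem_full _) _
  obtain ⟨Y', h0', h'⟩ := exists_euler_eq_mul k (ofFun (Coideal.full p) fun α => coeff α l)
    ((hc 0).trans hl0)
  refine ⟨Y', ⟨h0', _, fun α => (hc α).symm ▸ hl α, h'⟩, ?_⟩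
  have : ofFun Δ (fun α => coeff α Y') = Y := by
    refine eq_of_euler_eq_mul k hl0 ?_ (ext fun α hα => ?_) h
    · rw [coeff_ofFun Δ.zero_mem, h0, h0']
    · have e := congrArg (coeff α) h'
      rw [coeff_euler, coeff_mul (Coideal.mem_full _)] at e
      rw [coeff_euler, coeff_ofFun hα, e, coeff_mul hα]
      refine Finset.sum_congr rfl fun x hx => ?_
      rw [hc, coeff_ofFun (Δ.snd_mem hα hx)]
  intro α hα
  rw [← this, coeff_ofFun hα]

/-- Not only the radial logarithmic derivative but all partial ones lie in `L`: from `[∂_i, χ] =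
∂_i`, the series `m = ∂_i(Y) Y⁻¹` satisfies `χ(m) + m = ∂_i(l) + [l, m]`, which is
`coeff_mem_of_euler_sub_lie` with `c = 1`. -/
theorem IsFlow.exists_pderiv_eq_mul (hL : IsLRSubmodule ι L) {Y : TPS (Coideal.full p) R}
    (hY : IsFlow L Y) (i : Fin p) :
    ∃ m : TPS (Coideal.full p) R, (∀ α, coeff α m ∈ L) ∧ pderiv i Y = m * Y := by
  obtain ⟨h0, l, hl, h⟩ := hY
  obtain ⟨Z, hZ, hZ'⟩ := exists_inverse h0
  have hm : pderiv i Y = pderiv i Y * Z * Y := by rw [mul_assoc, hZ', mul_one]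
  refine ⟨pderiv i Y * Z, ?_, hm⟩
  generalize pderiv i Y * Z = m at hm
  refine coeff_mem_of_euler_sub_lie (coeff_zero_eq_zero_of_euler_eq_mul h0 h)
    (fun α => hL.lie_mem _ (hl α)) (F := pderiv i l) (fun α => ?_) 1 (by simp) ?_
  · rw [coeff_pderiv]
    exact L.nsmul_mem (hl _) _
  · have e := pderiv_euler_degree i Y
    rw [h, pderiv_mul, hm, euler_mul, h] at e
    have e2 : (euler Finsupp.degree m + 1 • m) * Y = (pderiv i l + (l * m - m * l)) * Y := by
      rw [one_smul, add_mul, add_mul, sub_mul, mul_assoc l, ← add_sub_assoc, e]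
      noncomm_ring
    have e3 := congrArg (· * Z) e2
    simpa only [mul_assoc, hZ, mul_one] using e3

end Flow

end TPS

/-! ### Chain rule and product rule for substitution maps with non-commutative coefficients. -/

namespace SubstMap

open TPS

variable {A R : Type*} [CommRing A] [Ring R] {p q : ℕ} {Δ : Coideal p} {Γ : Coideal q}

/-- The image of the monomial `s ^ β`. -/
noncomputable def mon (φ : SubstMap A Δ Γ) (β : Fin p →₀ ℕ) : TPS Γ A :=
  φ.toAlgHom (monomial Δ β 1)

theorem mon_zero (φ : SubstMap A Δ Γ) : φ.mon 0 = 1 := by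
  rw [mon, monomial_zero_eq_C]
  exact map_one φ.toAlgHom

theorem mon_add (φ : SubstMap A Δ Γ) (β γ : Fin p →₀ ℕ) : φ.mon (β + γ) = φ.mon β * φ.mon γ := by
  rw [mon, mon, mon, ← map_mul, monomial_mul, one_mul]

theorem coeff_bullet_eq_zero (φ : SubstMap A Δ Γ) (j : A →+* R) {f : TPS Δ R} {e : Fin q →₀ ℕ}
    (h : ∀ β, β.degree ≤ e.degree → coeff β f = 0) : coeff e (φ.bullet j f) = 0 := by
  by_cases he : e ∈ Γ
  · rw [φ.coeff_bullet j f he]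
    exact Finset.sum_eq_zero fun β hβ => by rw [h β (mem_degreeLE.1 hβ), mul_zero]
  · exact coeff_of_notMem he _

/-- The action of a substitution map as an additive map. -/
noncomputable def bulletHom (φ : SubstMap A Δ Γ) (j : A →+* R) : TPS Δ R →+ TPS Γ R where
  toFun := φ.bullet j
  map_zero' := ext' fun e => by
    rw [map_zero]
    exact φ.coeff_bullet_eq_zero j fun β _ => map_zero _
  map_add' f g := TPS.ext fun e he => by
    simp only [map_add, φ.coeff_bullet _ _ he, mul_add, Finset.sum_add_distrib]

theorem bulletHom_apply (φ : SubstMap A Δ Γ) (j : A →+* R) (f : TPS Δ R) :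
    φ.bulletHom j f = φ.bullet j f := rfl

theorem bullet_monomial (φ : SubstMap A Δ Γ) (j : A →+* R) (β : Fin p →₀ ℕ) (r : R) :
    φ.bullet j (monomial Δ β r) = mapRingHom j (φ.mon β) * C Γ r := by
  by_cases hβ : β ∈ Δ
  · refine TPS.ext fun e he => ?_
    have hc : ∀ γ, coeff γ (monomial Δ β r) = if γ = β then r else 0 := by
      intro γ
      by_cases hγ : γ ∈ Δ
      · exact coeff_monomial hγ _ _
      · rw [coeff_of_notMem hγ, if_neg]
        rintro rfl
        exact hγ hβ
    rw [φ.coeff_bullet j _ he, coeff_mul_C, coeff_mapRingHom]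
    simp only [hc, mul_ite, mul_zero, Finset.sum_ite_eq', mem_degreeLE]
    split_ifs with h
    · rfl
    · rw [mon, φ.coeff_monomial_eq_zero (not_le.1 h), map_zero, zero_mul]
  · rw [monomial_of_notMem hβ, mon, monomial_of_notMem hβ, map_zero, map_zero, zero_mul]
    exact (φ.bulletHom j).map_zero

/-- The coefficients of `φ(s ^ γ)` come from `A` and need not commute with `R`, while the action
always puts them on the left. This is why `φ(s ^ γ)` ends up in front of `φ • l`. -/
theorem bullet_mul_monomial (φ : SubstMap A (Coideal.full p) Γ) (j : A →+* R) (l : TPS _ R)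
    (γ : Fin p →₀ ℕ) (r : R) :
    φ.bullet j (l * monomial _ γ r) = mapRingHom j (φ.mon γ) * φ.bullet j l * C Γ r := by
  let G : TPS (Coideal.full p) R →+ TPS Γ R :=
    (φ.bulletHom j).comp (AddMonoidHom.mulRight (monomial _ γ r)) -
      (AddMonoidHom.mulRight (C Γ r)).comp
        ((AddMonoidHom.mulLeft (mapRingHom j (φ.mon γ))).comp (φ.bulletHom j))
  have hG : ∀ f, G f = φ.bullet j (f * monomial _ γ r) -
    mapRingHom j (φ.mon γ) * φ.bullet j f * C Γ r := fun _ => rfl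
  rw [← sub_eq_zero, ← hG]
  refine ext' fun e => ?_
  rw [map_zero]
  by_cases he : e ∈ Γ
  swap
  · exact coeff_of_notMem he _
  refine eq_zero_of_monomial ((coeff e).comp G) e.degree (fun f hf => ?_) (fun β s => ?_) l
  · rw [AddMonoidHom.comp_apply, hG, map_sub, φ.coeff_bullet_eq_zero j, coeff_mul_C, coeff_mul he,
      Finset.sum_eq_zero, zero_mul, sub_zero]
    · intro x hx
      rw [φ.coeff_bullet_eq_zero j, mul_zero]
      intro β hβ
      refine hf β (hβ.trans ?_)
      rw [← Finset.HasAntidiagonal.mem_antidiagonal.1 hx, map_add]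
      omega
    · intro β hβ
      rw [coeff_mul (Coideal.mem_full _)]
      refine Finset.sum_eq_zero fun x hx => ?_
      rw [hf, zero_mul]
      refine le_trans ?_ hβ
      rw [← Finset.HasAntidiagonal.mem_antidiagonal.1 hx, map_add]
      omega
  · rw [AddMonoidHom.comp_apply, hG, monomial_mul, bullet_monomial, bullet_monomial, add_comm β,
      mon_add, map_mul, C_mul]
    simp only [mul_assoc, sub_self, map_zero]

/-- The product rule for the images of the monomials. -/
theorem leibniz_mon (φ : SubstMap A Δ Γ) (j : A →+* R) (d : TPS Γ R →+ TPS Γ R)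
    (hd : ∀ f g, d (f * g) = d f * g + f * d g)
    (hc : ∀ i g, Commute (d (mapRingHom j (φ.mon (Finsupp.single i 1)))) (mapRingHom j g))
    (α : Fin p →₀ ℕ) :
    d (mapRingHom j (φ.mon α)) = ∑ i, α i • (d (mapRingHom j (φ.mon (Finsupp.single i 1))) *
      mapRingHom j (φ.mon (α - Finsupp.single i 1))) := by
  classical
  -- Induction step: one more variable `s_i` is split off. The hypothesis `hc` lets `φ(s_i)` pass
  -- the factors `d(φ(s_i'))`.
  have key : ∀ (i : Fin p) (α : Fin p →₀ ℕ), d (mapRingHom j (φ.mon α)) =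
      ∑ i, α i • (d (mapRingHom j (φ.mon (Finsupp.single i 1))) *
        mapRingHom j (φ.mon (α - Finsupp.single i 1))) →
      d (mapRingHom j (φ.mon (Finsupp.single i 1 + α))) =
      ∑ i', (Finsupp.single i 1 + α : Fin p →₀ ℕ) i' • (d (mapRingHom j (φ.mon (Finsupp.single i' 1))) *
        mapRingHom j (φ.mon (Finsupp.single i 1 + α - Finsupp.single i' 1))) := by
    intro i α ih
    simp only [Finsupp.add_apply, add_smul, Finset.sum_add_distrib]
    rw [mon_add, map_mul, hd, ih, Finset.mul_sum]
    congr 1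
    · rw [Finset.sum_eq_single i]
      · rw [Finsupp.single_eq_same, one_smul, add_tsub_cancel_left]
      · intro i' _ h
        rw [Finsupp.single_eq_of_ne h, zero_smul]
      · intro h
        exact absurd (Finset.mem_univ i) h
    · refine Finset.sum_congr rfl fun i' _ => ?_
      by_cases h : α i' = 0
      · rw [h, zero_smul, zero_smul, mul_zero]
      · have hle : Finsupp.single i' 1 ≤ α :=
          Finsupp.single_le_iff.2 (Nat.one_le_iff_ne_zero.2 h)
        rw [mul_smul_comm, ← mul_assoc, ← (hc i' _).eq, mul_assoc, ← map_mul, ← mon_add,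
          add_tsub_assoc_of_le hle]
  induction hn : α.degree generalizing α with
  | zero =>
    have h1 : d 1 = 0 := by simpa using hd 1 1
    rw [(Finsupp.degree_eq_zero_iff _).1 hn, mon_zero, map_one, h1]
    simp
  | succ n ih =>
    have hne : α ≠ 0 := by
      rintro rfl
      simp at hn
    obtain ⟨i, hi⟩ := Finsupp.ne_iff.1 hne
    obtain ⟨β, rfl⟩ := exists_add_of_le
      (Finsupp.single_le_iff.2 (Nat.one_le_iff_ne_zero.2 hi) : Finsupp.single i 1 ≤ α)
    refine key i β (ih β ?_)
    rw [map_add, Finsupp.degree_single] at hn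
    omega

theorem coeff_eq_zero_of_pderiv_sum (φ : SubstMap A (Coideal.full p) Γ) (j : A →+* R)
    (u : Fin p → TPS Γ R) {f : TPS (Coideal.full p) R} {e : Fin q →₀ ℕ} (he : e ∈ Γ)
    (hf : ∀ β, β.degree ≤ e.degree + 1 → coeff β f = 0) :
    coeff e (∑ i, u i * φ.bullet j (pderiv i f)) = 0 := by
  rw [map_sum]
  refine Finset.sum_eq_zero fun i _ => ?_
  rw [coeff_mul he]
  refine Finset.sum_eq_zero fun x hx => ?_
  rw [φ.coeff_bullet_eq_zero j, mul_zero]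
  intro β hβ
  rw [coeff_pderiv, hf, smul_zero]
  rw [← Finset.HasAntidiagonal.mem_antidiagonal.1 hx, map_add, map_add, Finsupp.degree_single]
  omega

/-- The chain rule. -/
theorem euler_bullet (φ : SubstMap A (Coideal.full p) Γ) (j : A →+* R) (w : (Fin q →₀ ℕ) →+ ℕ)
    (Y : TPS (Coideal.full p) R) :
    euler w (φ.bullet j Y) = ∑ i, euler w (mapRingHom j (φ.mon (Finsupp.single i 1))) *
      φ.bullet j (pderiv i Y) := by
  let G : TPS (Coideal.full p) R →+ TPS Γ R := (euler w).comp (φ.bulletHom j) -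
    ∑ i, (AddMonoidHom.mulLeft (euler w (mapRingHom j (φ.mon (Finsupp.single i 1))))).comp
      ((φ.bulletHom j).comp (pderiv i))
  have hG : ∀ f, G f = euler w (φ.bullet j f) -
      ∑ i, euler w (mapRingHom j (φ.mon (Finsupp.single i 1))) * φ.bullet j (pderiv i f) := by
    intro f
    rw [AddMonoidHom.sub_apply, AddMonoidHom.finsetSum_apply]
    rfl
  rw [← sub_eq_zero, ← hG]
  refine ext' fun e => ?_
  rw [map_zero]
  by_cases he : e ∈ Γ
  swap
  · exact coeff_of_notMem he _
  -- The bound is `|e| + 1` instead of `|e|` because the partial derivatives read coefficients one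
  -- degree higher.
  refine eq_zero_of_monomial ((coeff e).comp G) (e.degree + 1) (fun f hf => ?_) (fun β s => ?_) Y
  · rw [AddMonoidHom.comp_apply, hG, map_sub, φ.coeff_eq_zero_of_pderiv_sum j _ he hf, coeff_euler,
      φ.coeff_bullet_eq_zero j fun β hβ => hf β (by omega), smul_zero, sub_zero]
  · rw [AddMonoidHom.comp_apply, hG, bullet_monomial, euler_mul, euler_C, mul_zero, add_zero,
      φ.leibniz_mon j (euler w) (euler_mul w), Finset.sum_mul]
    · rw [← map_zero (coeff e), ← Finset.sum_sub_distrib]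
      congr 1
      refine Finset.sum_eq_zero fun i _ => ?_
      rw [pderiv_monomial, ← bulletHom_apply, map_nsmul, bulletHom_apply, bullet_monomial,
        smul_mul_assoc, mul_smul_comm, mul_assoc, sub_self]
    · intro i g
      rw [euler_mapRingHom]
      exact (Commute.all _ g).map (mapRingHom j)

/-- The failure of multiplicativity of the action of a substitution map. -/
theorem bullet_mul (φ : SubstMap A (Coideal.full p) Γ) (j : A →+* R) (l : TPS (Coideal.full p) R)
    (hl : ∀ i g, Commute (φ.bullet j l * mapRingHom j (φ.mon (Finsupp.single i 1)) -
      mapRingHom j (φ.mon (Finsupp.single i 1)) * φ.bullet j l) (mapRingHom j g))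
    (Y : TPS (Coideal.full p) R) :
    φ.bullet j (l * Y) = φ.bullet j l * φ.bullet j Y -
      ∑ i, (φ.bullet j l * mapRingHom j (φ.mon (Finsupp.single i 1)) -
        mapRingHom j (φ.mon (Finsupp.single i 1)) * φ.bullet j l) *
        φ.bullet j (pderiv i Y) := by
  -- For `Y = r s ^ β` the defect is the bracket of `φ • l` with `φ(s ^ β)`, times `r`. As `ad` is a
  -- derivation, `leibniz_mon` expands it into brackets with the `φ(s_i)`, exactly as in the chain
  -- rule.
  let ad : TPS Γ R →+ TPS Γ R := AddMonoidHom.mulLeft (φ.bullet j l) -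
    AddMonoidHom.mulRight (φ.bullet j l)
  have had : ∀ f, ad f = φ.bullet j l * f - f * φ.bullet j l := fun _ => rfl
  simp only [← had] at hl ⊢
  let G : TPS (Coideal.full p) R →+ TPS Γ R :=
    (φ.bulletHom j).comp (AddMonoidHom.mulLeft l) -
      (AddMonoidHom.mulLeft (φ.bullet j l)).comp (φ.bulletHom j) +
    ∑ i, (AddMonoidHom.mulLeft (ad (mapRingHom j (φ.mon (Finsupp.single i 1))))).comp
      ((φ.bulletHom j).comp (pderiv i))
  have hG : ∀ f, G f = φ.bullet j (l * f) - φ.bullet j l * φ.bullet j f +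
      ∑ i, ad (mapRingHom j (φ.mon (Finsupp.single i 1))) * φ.bullet j (pderiv i f) := by
    intro f
    rw [AddMonoidHom.add_apply, AddMonoidHom.finsetSum_apply]
    rfl
  suffices h : G Y = 0 by
    rw [hG] at h
    rw [eq_sub_iff_add_eq, ← sub_eq_zero, ← h]
    abel
  refine ext' fun e => ?_
  rw [map_zero]
  by_cases he : e ∈ Γ
  swap
  · exact coeff_of_notMem he _
  refine eq_zero_of_monomial ((coeff e).comp G) (e.degree + 1) (fun f hf => ?_) (fun β s => ?_) Y
  · rw [AddMonoidHom.comp_apply, hG, map_add, map_sub, φ.coeff_eq_zero_of_pderiv_sum j _ he hf,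
      φ.coeff_bullet_eq_zero j, coeff_mul he, Finset.sum_eq_zero, sub_zero, add_zero]
    · intro x hx
      rw [φ.coeff_bullet_eq_zero j (f := f), mul_zero]
      intro β hβ
      refine hf β ?_
      rw [← Finset.HasAntidiagonal.mem_antidiagonal.1 hx, map_add]
      omega
    · intro β hβ
      rw [coeff_mul (Coideal.mem_full _)]
      refine Finset.sum_eq_zero fun x hx => ?_
      rw [hf x.2, mul_zero]
      rw [← Finset.HasAntidiagonal.mem_antidiagonal.1 hx, map_add] at hβ
      omega
  · have h1 : ∑ i, ad (mapRingHom j (φ.mon (Finsupp.single i 1))) *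
        φ.bullet j (pderiv i (monomial _ β s)) = ad (mapRingHom j (φ.mon β)) * C Γ s := by
      rw [φ.leibniz_mon j ad (fun f g => by simp only [had]; noncomm_ring) hl, Finset.sum_mul]
      refine Finset.sum_congr rfl fun i _ => ?_
      rw [pderiv_monomial, ← bulletHom_apply, map_nsmul, bulletHom_apply, bullet_monomial,
        smul_mul_assoc, mul_smul_comm, mul_assoc]
    rw [AddMonoidHom.comp_apply, hG, h1, bullet_mul_monomial, bullet_monomial, had]
    rw [← map_zero (coeff e)]
    congr 1
    noncomm_ring

/-- The projection `A[[s]] → A[[s]]_Δ`. -/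
noncomputable def proj {p : ℕ} {Δ Δ' : Coideal p} (h : ∀ α, α ∈ Δ' → α ∈ Δ) (A : Type*)
    [CommRing A] : SubstMap A Δ Δ' where
  toAlgHom := Ideal.Quotient.factorₐ A (I := truncIdeal Δ A) (J := truncIdeal Δ' A)
    fun _ hf α hα => hf α (h α hα)
  ord_pos i := by
    change coeff 0 (monomial Δ' (Finsupp.single i 1) (1 : A)) = 0
    rw [coeff_monomial Δ'.zero_mem, if_neg (by simp [eq_comm])]

/-- The composition of substitution maps. -/
noncomputable def compProj (φ : SubstMap A Δ Γ) : SubstMap A (Coideal.full p) Γ where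
  toAlgHom := φ.toAlgHom.comp (proj (fun α _ => Coideal.mem_full α) A).toAlgHom
  ord_pos := φ.ord_pos

/-- The action can be computed on any lift to `R[[s]]`, where partial derivatives exist: the
monomials outside `Δ` have image `0`. -/
theorem compProj_bullet (φ : SubstMap A Δ Γ) (j : A →+* R) {Y : TPS Δ R}
    {Y' : TPS (Coideal.full p) R} (h : ∀ α ∈ Δ, coeff α Y' = coeff α Y) :
    φ.compProj.bullet j Y' = φ.bullet j Y := by
  refine TPS.ext fun e he => ?_
  rw [coeff_bullet _ _ _ he, coeff_bullet _ _ _ he]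
  refine Finset.sum_congr rfl fun β _ => ?_
  change j (coeff e (φ.toAlgHom (monomial Δ β 1))) * _ = _
  by_cases hβ : β ∈ Δ
  · rw [h β hβ]
  · rw [monomial_of_notMem hβ, map_zero, map_zero, map_zero, zero_mul, zero_mul]

theorem coeff_proj_bullet {p : ℕ} {Δ Δ' : Coideal p} (h : ∀ α, α ∈ Δ' → α ∈ Δ) (j : A →+* R)
    (r : TPS Δ R) {α : Fin p →₀ ℕ} (hα : α ∈ Δ') :
    coeff α ((proj h A).bullet j r) = coeff α r := by
  rw [coeff_bullet _ _ _ hα, Finset.sum_eq_single α]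
  · change j (coeff α (monomial Δ' α 1)) * _ = _
    rw [coeff_monomial hα, if_pos rfl, map_one, one_mul]
  · intro β _ hβ
    change j (coeff α (monomial Δ' β 1)) * _ = _
    rw [coeff_monomial hα, if_neg hβ.symm, map_zero, zero_mul]
  · intro h'
    exact absurd (mem_degreeLE.2 le_rfl) h'

end SubstMap

/-! ### Stability of flows under substitution maps. -/

namespace TPS

variable {k A R : Type*} [CommRing k] [CommRing A] [Algebra k A] [Ring R]
  [Algebra k R] {ι : A →ₐ[k] R} {L : Submodule k R} {p q : ℕ} {Δ : Coideal p} {Γ : Coideal q}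

theorem coeff_mem_mapRingHom_mul (hL : IsLRSubmodule ι L) (f : TPS Δ A) {m : TPS Δ R}
    (hm : ∀ α, coeff α m ∈ L) (α : Fin p →₀ ℕ) : coeff α (mapRingHom ι.toRingHom f * m) ∈ L := by
  by_cases hα : α ∈ Δ
  · rw [coeff_mul hα]
    refine L.sum_mem fun x _ => ?_
    rw [coeff_mapRingHom]
    exact hL.smul_mem _ _ (hm _)
  · rw [coeff_of_notMem hα]
    exact L.zero_mem

theorem exists_mapRingHom_eq_lie (hL : IsLRSubmodule ι L) {m : TPS Δ R}
    (hm : ∀ α, coeff α m ∈ L) (f : TPS Δ A) :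
    ∃ g : TPS Δ A, m * mapRingHom ι.toRingHom f - mapRingHom ι.toRingHom f * m =
      mapRingHom ι.toRingHom g := by
  refine exists_mapRingHom_eq fun α => ?_
  by_cases hα : α ∈ Δ
  · rw [coeff_mul_sub_mul hα]
    choose b hb using fun x : (Fin p →₀ ℕ) × (Fin p →₀ ℕ) =>
      hL.lie_ι _ (hm x.1) (coeff x.2 f)
    refine ⟨∑ x ∈ Finset.HasAntidiagonal.antidiagonal α, b x, ?_⟩
    rw [map_sum]
    refine Finset.sum_congr rfl fun x _ => ?_
    rw [coeff_mapRingHom]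
    exact hb x
  · exact ⟨0, by rw [coeff_of_notMem hα, map_zero]⟩

/-- By the chain rule, the logarithmic derivative of `φ • Y` is `∑ χ(φ(s_i)) V_i` with `V_i = (φ •
∂_i Y)(φ • Y)⁻¹`, so it suffices that the `V_i` have coefficients in `L`. Write `∂_i Y = m_i Y` with
`m_i` in `L`. The defect formula `bullet_mul` gives the linear system `V_i = φ • m_i - ∑ b_{i i'}
V_{i'}`, where `b_{i i'} = [φ • m_i, φ(s_i')]` has coefficients in `A`. As `φ(s_i')` has no constant
term, neither has `b_{i i'}`, and the system is solved within `L` by induction on the degree. -/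
theorem IsFlow.bullet [Algebra ℚ k] (hL : IsLRSubmodule ι L) (φ : SubstMap A Δ Γ) {Y : TPS Δ R}
    (hY : IsFlow L Y) : IsFlow L (φ.bullet ι.toRingHom Y) := by
  obtain ⟨Y', hY', h'⟩ := hY.exists_lift
  rw [← φ.compProj_bullet _ h']
  generalize φ.compProj = ψ
  set j := ι.toRingHom with hj
  have h0 : coeff 0 (ψ.bullet j Y') = 1 := by rw [ψ.coeff_zero_bullet, hY'.1]
  choose m hm hd using hY'.exists_pderiv_eq_mul hL
  have hN : ∀ i α, coeff α (ψ.bullet j (m i)) ∈ L := by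
    intro i α
    by_cases hα : α ∈ Γ
    · rw [ψ.coeff_bullet _ _ hα]
      exact L.sum_mem fun β _ => hL.smul_mem _ _ (hm i β)
    · rw [coeff_of_notMem hα]
      exact L.zero_mem
  choose b hb using fun i i' => exists_mapRingHom_eq_lie hL (hN i) (ψ.mon (Finsupp.single i' 1))
  rw [← hj] at hb
  -- This is where the order condition on substitution maps makes the linear system triangular.
  have hb0 : ∀ i i', coeff 0 (mapRingHom j (b i i')) = 0 := by
    intro i i'
    rw [← hb, map_sub, coeff_zero_mul, coeff_zero_mul, coeff_mapRingHom, SubstMap.mon, ψ.ord_pos]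
    simp
  have hW : ∀ i, ψ.bullet j (pderiv i Y') = ψ.bullet j (m i) * ψ.bullet j Y' -
      ∑ i', mapRingHom j (b i i') * ψ.bullet j (pderiv i' Y') := by
    intro i
    conv_lhs => rw [hd]
    rw [ψ.bullet_mul j (m i)]
    · simp only [hb]
    · intro i' g
      rw [hb]
      exact (Commute.all _ g).map (mapRingHom j)
  obtain ⟨Z, hZ, hZ'⟩ := exists_inverse h0
  have hV : ∀ i, ψ.bullet j (pderiv i Y') * Z = ψ.bullet j (m i) -
      ∑ i', mapRingHom j (b i i') * (ψ.bullet j (pderiv i' Y') * Z) := by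
    intro i
    conv_lhs => rw [hW, sub_mul, mul_assoc, hZ, mul_one, Finset.sum_mul]
    simp only [mul_assoc]
  have hVL : ∀ α i, coeff α (ψ.bullet j (pderiv i Y') * Z) ∈ L := by
    intro α
    by_cases hα : α ∈ Γ
    swap
    · intro i
      rw [coeff_of_notMem hα]
      exact L.zero_mem
    induction hn : α.degree using Nat.strong_induction_on generalizing α with
    | _ n ih =>
      intro i
      rw [hV, map_sub, map_sum]
      refine L.sub_mem (hN i α) (L.sum_mem fun i' _ => ?_)
      rw [coeff_mul hα]
      refine L.sum_mem fun x hx => ?_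
      by_cases hx0 : x.1 = 0
      · rw [hx0, hb0, zero_mul]
        exact L.zero_mem
      · rw [coeff_mapRingHom]
        exact hL.smul_mem _ _ (ih _ (hn ▸ Finsupp.degree_snd_lt_of_mem_antidiagonal hx hx0) _
          (Γ.snd_mem hα hx) rfl i')
  refine ⟨h0, ∑ i, euler Finsupp.degree (mapRingHom j (ψ.mon (Finsupp.single i 1))) *
    (ψ.bullet j (pderiv i Y') * Z), fun α => ?_, ?_⟩
  · rw [map_sum]
    refine L.sum_mem fun i _ => ?_
    rw [euler_mapRingHom]
    exact coeff_mem_mapRingHom_mul hL _ (fun α => hVL α i) α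
  · rw [ψ.euler_bullet, Finset.sum_mul]
    refine Finset.sum_congr rfl fun i _ => ?_
    rw [mul_assoc, mul_assoc, hZ', mul_one]

end TPS

theorem degree_expOne : expOne.degree = 1 := by rw [expOne, Finsupp.degree_single]

theorem SubstMap.mapRingHom_bullet {A R R' : Type*} [CommRing A] [Ring R] [Ring R'] {p q : ℕ}
    {Δ : Coideal p} {Γ : Coideal q} (φ : SubstMap A Δ Γ) (j : A →+* R) (g : R →+* R')
    (r : TPS Δ R) :
    TPS.mapRingHom g (φ.bullet j r) = φ.bullet (g.comp j) (TPS.mapRingHom g r) :=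
  TPS.ext fun e he => by
    rw [TPS.coeff_mapRingHom, φ.coeff_bullet _ _ he, φ.coeff_bullet _ _ he, map_sum]
    refine Finset.sum_congr rfl fun β _ => ?_
    rw [map_mul, TPS.coeff_mapRingHom]
    rfl

/-! ### Logarithmic derivatives of Hasse–Schmidt derivations. -/

namespace HS

open TPS

variable {k A : Type*} [CommRing k] [CommRing A] [Algebra k A] {p : ℕ} {Δ : Coideal p}

/-- Multiplication by the elements of `A`, as a ring homomorphism. -/
noncomputable abbrev lmulHom (k A : Type*) [CommRing k] [CommRing A] [Algebra k A] :
    A →+* Module.End k A := (Algebra.lmul k A : A →ₐ[k] Module.End k A).toRingHom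

theorem lmulHom_apply (a b : A) : lmulHom k A a b = a * b := rfl

theorem lmulHom_injective : Function.Injective (lmulHom k A) := fun a b h => by
  have := LinearMap.congr_fun h 1
  rwa [lmulHom_apply, lmulHom_apply, mul_one, mul_one] at this

theorem mul_C_lmul (D : HS k A Δ) (a : A) :
    (D : TPS Δ (Module.End k A)) * C Δ (lmulHom k A a) =
      mapRingHom (lmulHom k A) (evalSeries (D : TPS Δ (Module.End k A)) a) * D := by
  refine TPS.ext fun α hα => LinearMap.ext fun x => ?_
  rw [coeff_mul_C, coeff_mul hα, LinearMap.sum_apply]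
  refine (D.2.2 α hα a x).trans (Finset.sum_congr rfl fun z _ => ?_)
  rw [coeff_mapRingHom, coeff_evalSeries]
  rfl

/-- `D(1)` is idempotent, and a unit because its constant term is `1`. -/
theorem evalSeries_one (D : HS k A Δ) : evalSeries (D : TPS Δ (Module.End k A)) 1 = 1 := by
  have h := (mem_HS_iff.1 D.2).2 1 1
  have hu : coeff 0 (evalSeries (D : TPS Δ (Module.End k A)) 1) = 1 := by
    rw [coeff_evalSeries, D.2.1, Module.End.one_apply]
  rw [mul_one] at h
  exact (isUnit_of_mem_U (Δ := Δ) hu).mul_left_cancel (by rw [← h, mul_one])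

theorem coeff_apply_one (D : HS k A Δ) {α : Fin p →₀ ℕ} (hα : α ≠ 0) :
    coeff α (D : TPS Δ (Module.End k A)) 1 = 0 := by
  by_cases h : α ∈ Δ
  · rw [← coeff_evalSeries, evalSeries_one, coeff_one h, if_neg hα]
  · rw [coeff_of_notMem h, LinearMap.zero_apply]

/-- The logarithmic derivative of a Hasse–Schmidt derivation consists of derivations. -/
theorem exists_euler_eq_derivation_mul (D : HS k A Δ) :
    ∃ ε : (Fin p →₀ ℕ) → Derivation k A A, ε 0 = 0 ∧
      euler Finsupp.degree (D : TPS Δ (Module.End k A)) =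
        ofFun Δ (fun α => ((ε α : A →ₗ[k] A) : Module.End k A)) * D := by
  obtain ⟨Z, hZ, hZ'⟩ := exists_inverse D.2.1
  have hE : euler Finsupp.degree (D : TPS Δ (Module.End k A)) =
      euler Finsupp.degree (D : TPS Δ (Module.End k A)) * Z * D := by
    rw [mul_assoc, hZ', mul_one]
  generalize euler Finsupp.degree (D : TPS Δ (Module.End k A)) * Z = E at hE
  have hE0 := coeff_zero_eq_zero_of_euler_eq_mul D.2.1 hE
  -- Evaluate `χ(D) = E D` at `1`: as `D_γ(1) = 0` for `γ ≠ 0`, the coefficient at `α` reduces to `0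
  -- = E_α(1)`.
  have hone : ∀ α, coeff α E 1 = 0 := by
    intro α
    by_cases hα : α ∈ Δ
    swap
    · rw [coeff_of_notMem hα, LinearMap.zero_apply]
    by_cases h0 : α = 0
    · rw [h0, hE0, LinearMap.zero_apply]
    have h := LinearMap.congr_fun (congrArg (coeff α) hE) 1
    rw [coeff_euler, coeff_mul hα, LinearMap.smul_apply, coeff_apply_one D h0, smul_zero,
      LinearMap.sum_apply, Finset.sum_eq_single (α, 0)] at h
    · simpa [D.2.1] using h.symm
    · intro x hx hne
      have hx2 : x.2 ≠ 0 := by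
        intro h2
        refine hne (Prod.ext ?_ h2)
        rw [← Finset.HasAntidiagonal.mem_antidiagonal.1 hx, h2, add_zero]
      rw [Module.End.mul_apply, coeff_apply_one D hx2, map_zero]
    · intro h'
      exact absurd (Finset.HasAntidiagonal.mem_antidiagonal.2 (add_zero α)) h'
  let S : Submodule k (Module.End k A) := LinearMap.range (Algebra.lmul k A).toLinearMap
  have hS : ∀ a, lmulHom k A a ∈ S := fun a => ⟨a, rfl⟩
  -- `D a D⁻¹` is multiplication by the series `D(a)`, so `χ(D(a)) = [E, D(a)]`. Its coefficient at
  -- `α` is `[E_α, a]` plus brackets of `E_β`, `|β| < |α|`, with elements of `A`. By induction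
  -- `[E_α, a]` is a multiplication.
  have hlie : ∀ α a, coeff α E * lmulHom k A a - lmulHom k A a * coeff α E ∈ S := by
    intro α
    by_cases hα : α ∈ Δ
    swap
    · intro a
      rw [coeff_of_notMem hα, zero_mul, mul_zero, sub_zero]
      exact S.zero_mem
    induction hn : α.degree using Nat.strong_induction_on generalizing α with
    | _ n ih =>
      intro a
      have h := euler_conj hZ hZ' hE (C Δ (lmulHom k A a))
      rw [euler_C, mul_zero, zero_mul, zero_add, mul_C_lmul, mul_assoc, hZ, mul_one,
        euler_mapRingHom] at h
      have h' := congrArg (coeff α) h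
      rw [coeff_mul_sub_mul hα] at h'
      have hmem : (α, (0 : Fin p →₀ ℕ)) ∈ Finset.HasAntidiagonal.antidiagonal α :=
        Finset.HasAntidiagonal.mem_antidiagonal.2 (add_zero α)
      rw [← Finset.add_sum_erase _ _ hmem] at h'
      simp only [coeff_mapRingHom, coeff_evalSeries, D.2.1, Module.End.one_apply] at h'
      rw [eq_sub_of_add_eq h'.symm]
      refine S.sub_mem (hS _) (S.sum_mem fun x hx => ?_)
      obtain ⟨hne, hx⟩ := Finset.mem_erase.1 hx
      refine ih _ (hn ▸ Finsupp.degree_fst_lt_of_mem_antidiagonal hx fun h2 => hne ?_) _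
        (Δ.fst_mem hα hx) rfl _
      refine Prod.ext ?_ h2
      rw [← Finset.HasAntidiagonal.mem_antidiagonal.1 hx, h2, add_zero]
  -- If `[E_α, a]` is multiplication by `c`, evaluation at `1` together with `E_α(1) = 0` gives `c =
  -- E_α(a)`, which is the Leibniz rule for `E_α`.
  let ε : (Fin p →₀ ℕ) → Derivation k A A := fun α => Derivation.mk' (coeff α E) (by
    intro a b
    obtain ⟨c, hc⟩ := hlie α a
    have hc' : ∀ b, c * b = coeff α E (a * b) - a * coeff α E b := fun b =>
      LinearMap.congr_fun hc b
    have h1 := hc' 1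
    rw [mul_one, mul_one, hone, mul_zero, sub_zero] at h1
    have h2 := hc' b
    rw [h1] at h2
    rw [smul_eq_mul, smul_eq_mul, mul_comm b, h2]
    ring)
  have hε : ∀ α, (((ε α) : A →ₗ[k] A) : Module.End k A) = coeff α E := fun α => rfl
  refine ⟨ε, Derivation.ext fun a => ?_, ?_⟩
  · exact LinearMap.congr_fun hE0 a
  · simp only [hε, ofFun_coeff]
    exact hE

end HS

/-! ### The HS-structure of an LR-admissible map. -/

namespace IsLRAdmissible

open TPS HS

variable {k A R : Type*} [CommRing k] [CommRing A] [Algebra k A] [Ring R]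
  [Algebra k R] {ι : A →ₐ[k] R} {nabla : Derivation k A A → R}

/-- The graph of an LR-admissible map. -/
noncomputable def graphMap (h : IsLRAdmissible ι nabla) :
    Derivation k A A →ₗ[k] R × Module.End k A where
  toFun δ := (nabla δ, (δ : A →ₗ[k] A))
  map_add' δ δ' := Prod.ext (h.map_add δ δ') rfl
  map_smul' c δ := Prod.ext (by
    have : c • δ = algebraMap k A c • δ := by rw [algebraMap_smul]
    change nabla (c • δ) = c • nabla δ
    rw [this, h.map_smul, AlgHom.commutes, Algebra.smul_def]) rfl

/-- The image of the graph of an LR-admissible map. -/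
noncomputable abbrev graph (h : IsLRAdmissible ι nabla) : Submodule k (R × Module.End k A) :=
  LinearMap.range h.graphMap

/-- The structure map of `R × End_k(A)`. -/
noncomputable abbrev prodHom (ι : A →ₐ[k] R) : A →ₐ[k] R × Module.End k A :=
  ι.prod (Algebra.lmul k A)

theorem isLRSubmodule_graph (h : IsLRAdmissible ι nabla) :
    IsLRSubmodule (prodHom ι) h.graph where
  smul_mem := by
    rintro a _ ⟨δ, rfl⟩
    exact ⟨a • δ, Prod.ext (h.map_smul a δ) rfl⟩
  lie_mem := by
    rintro _ ⟨δ, rfl⟩ _ ⟨δ', rfl⟩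
    refine ⟨⁅δ, δ'⁆, Prod.ext (h.map_lie δ δ') (LinearMap.ext fun x => ?_)⟩
    exact Derivation.commutator_apply x
  lie_ι := by
    rintro _ ⟨δ, rfl⟩ a
    refine ⟨δ a, Prod.ext ?_ (LinearMap.ext fun x => ?_)⟩
    · change nabla δ * ι a - ι a * nabla δ = ι (δ a)
      rw [h.leibniz, add_sub_cancel_left]
    · change δ (a * x) - a * δ x = δ a * x
      rw [Derivation.leibniz, smul_eq_mul, smul_eq_mul, add_sub_cancel_left, mul_comm]

variable {p : ℕ} {Δ : Coideal p}

theorem fst_mapRingHom_prodHom (f : TPS Δ A) : mapRingHom (RingHom.fst R (Module.End k A))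
    (mapRingHom (prodHom ι).toRingHom f) = mapCoeff (ι : A →+ R) f :=
  ext' fun α => by rw [coeff_mapRingHom, coeff_mapRingHom, coeff_mapCoeff]; rfl

/-- A derivation is determined by its underlying endomorphism. The map `∇` itself may have a kernel,
which is why the graph replaces its image. -/
theorem snd_injOn_graph (h : IsLRAdmissible ι nabla) {x y : R × Module.End k A} (hx : x ∈ h.graph)
    (hy : y ∈ h.graph) (hxy : x.2 = y.2) : x = y := by
  obtain ⟨δ, rfl⟩ := hx
  obtain ⟨δ', rfl⟩ := hy
  have : δ = δ' := Derivation.ext fun a => LinearMap.congr_fun hxy a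
  rw [this]

variable [Algebra ℚ k]

/-- Solve the equation with `l` the graph of `∇` over the logarithmic derivative of `D`. The second
component of the solution satisfies the equation of `D`, hence equals `D`. -/
theorem exists_flow (h : IsLRAdmissible ι nabla) (D : HS k A Δ) :
    ∃ Y : TPS Δ (R × Module.End k A), IsFlow h.graph Y ∧
      mapRingHom (RingHom.snd R (Module.End k A)) Y = D := by
  obtain ⟨ε, h0, hε⟩ := HS.exists_euler_eq_derivation_mul D
  have hl0 : coeff 0 (ofFun Δ fun α => h.graphMap (ε α)) = 0 := by
    rw [coeff_ofFun Δ.zero_mem, h0, map_zero]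
  have hs : mapRingHom (RingHom.snd R (Module.End k A)) (ofFun Δ fun α => h.graphMap (ε α)) =
      ofFun Δ fun α => ((ε α : A →ₗ[k] A) : Module.End k A) := TPS.ext fun α hα => by
    rw [coeff_mapRingHom, coeff_ofFun hα, coeff_ofFun hα]
    rfl
  obtain ⟨Y, hY0, hY⟩ := exists_euler_eq_mul k (ofFun Δ fun α => h.graphMap (ε α)) hl0
  refine ⟨Y, ⟨hY0, _, fun α => ?_, hY⟩, ?_⟩
  · by_cases hα : α ∈ Δ
    · rw [coeff_ofFun hα]
      exact ⟨_, rfl⟩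
    · rw [coeff_of_notMem hα]
      exact h.graph.zero_mem
  · refine eq_of_euler_eq_mul k ?_ ?_ ?_ hε
    · rw [coeff_ofFun Δ.zero_mem, h0]
      rfl
    · rw [coeff_mapRingHom, hY0, D.2.1, map_one]
    · rw [euler_mapRingHom, hY, map_mul, hs]

/-- The second component determines its own logarithmic derivative, hence `l` by injectivity on the
graph, hence `Y`. -/
theorem flow_unique (h : IsLRAdmissible ι nabla) {Y Y' : TPS Δ (R × Module.End k A)}
    (hY : IsFlow h.graph Y) (hY' : IsFlow h.graph Y')
    (hs : mapRingHom (RingHom.snd R (Module.End k A)) Y =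
      mapRingHom (RingHom.snd R (Module.End k A)) Y') : Y = Y' := by
  obtain ⟨h0, l, hl, hd⟩ := hY
  obtain ⟨h0', l', hl', hd'⟩ := hY'
  have hsl : mapRingHom (RingHom.snd R (Module.End k A)) l =
      mapRingHom (RingHom.snd R (Module.End k A)) l' := by
    have e := congrArg (mapRingHom (RingHom.snd R (Module.End k A))) hd
    have e' := congrArg (mapRingHom (RingHom.snd R (Module.End k A))) hd'
    rw [map_mul, ← euler_mapRingHom] at e e'
    rw [hs, e'] at e
    have hu : coeff 0 (mapRingHom (RingHom.snd R (Module.End k A)) Y') = 1 := by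
      rw [coeff_mapRingHom, h0', map_one]
    exact ((isUnit_of_mem_U (Δ := Δ) hu).mul_right_cancel e).symm
  have hll : l = l' := ext' fun α => h.snd_injOn_graph (hl α) (hl' α) (by
    have := congrArg (coeff α) hsl
    rwa [coeff_mapRingHom, coeff_mapRingHom] at this)
  subst hll
  exact eq_of_euler_eq_mul k (coeff_zero_eq_zero_of_euler_eq_mul h0 hd) (h0.trans h0'.symm) hd hd'

/-- The lift of a Hasse–Schmidt derivation to a flow on the graph of an LR-admissible map. -/
noncomputable def flow (h : IsLRAdmissible ι nabla) (D : HS k A Δ) :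
    TPS Δ (R × Module.End k A) := (h.exists_flow D).choose

theorem isFlow_flow (h : IsLRAdmissible ι nabla) (D : HS k A Δ) : IsFlow h.graph (h.flow D) :=
  (h.exists_flow D).choose_spec.1

theorem snd_flow (h : IsLRAdmissible ι nabla) (D : HS k A Δ) :
    mapRingHom (RingHom.snd R (Module.End k A)) (h.flow D) = D :=
  (h.exists_flow D).choose_spec.2

theorem flow_eq (h : IsLRAdmissible ι nabla) {D : HS k A Δ} {Y : TPS Δ (R × Module.End k A)}
    (hY : IsFlow h.graph Y) (hs : mapRingHom (RingHom.snd R (Module.End k A)) Y = D) :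
    h.flow D = Y :=
  h.flow_unique (h.isFlow_flow D) hY ((h.snd_flow D).trans hs.symm)

/-- Conjugation by the flow preserves the series with coefficients in `A`, so `Y a = f Y` for some
series `f` over `A`. The second component identifies `f` with `D(a)`, since `A → End_k(A)` is
injective. -/
theorem flow_leibniz (h : IsLRAdmissible ι nabla) (D : HS k A Δ) (a : A) :
    h.flow D * C Δ (prodHom ι a) = mapRingHom (prodHom ι).toRingHom
      (evalSeries (D : TPS Δ (Module.End k A)) a) * h.flow D := by
  obtain ⟨Z, hZ, hZ'⟩ := exists_inverse (h.isFlow_flow D).1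
  have hX := (h.isFlow_flow D).conj hZ (S := LinearMap.range (prodHom ι).toLinearMap)
    (m := C Δ (prodHom ι a)) (by
      rintro l hl _ ⟨b, rfl⟩
      obtain ⟨c, hc⟩ := h.isLRSubmodule_graph.lie_ι l hl b
      exact ⟨c, hc.symm⟩) (fun α => by
      by_cases hα : α ∈ Δ
      · rw [coeff_C hα]
        split_ifs
        · exact ⟨a, rfl⟩
        · exact Submodule.zero_mem _
      · rw [coeff_of_notMem hα]
        exact Submodule.zero_mem _)
  obtain ⟨f, hf⟩ := exists_mapRingHom_eq (f := (prodHom ι).toRingHom) fun α =>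
    (hX α).imp fun _ => Eq.symm
  have hf' : h.flow D * C Δ (prodHom ι a) = mapRingHom (prodHom ι).toRingHom f * h.flow D := by
    rw [← hf, mul_assoc, hZ', mul_one]
  have hs : ∀ f, mapRingHom (RingHom.snd R (Module.End k A))
      (mapRingHom (Δ := Δ) (prodHom ι).toRingHom f) = mapRingHom (lmulHom k A) f := fun f =>
    ext' fun α => by rw [coeff_mapRingHom, coeff_mapRingHom, coeff_mapRingHom]; rfl
  have e := congrArg (mapRingHom (RingHom.snd R (Module.End k A))) hf'
  rw [map_mul, map_mul, snd_flow, mapRingHom_C, hs] at e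
  have e' := mul_C_lmul D a
  change _ * C Δ (lmulHom k A a) = _ at e
  rw [e] at e'
  have hu : IsUnit (D : TPS Δ (Module.End k A)) := isUnit_of_mem_U (Δ := Δ) D.2.1
  rw [hf', mapRingHom_injective lmulHom_injective (hu.mul_right_cancel e')]

/-- The HS-structure of an LR-admissible map, over a `ℚ`-algebra. -/
noncomputable def hsStructure (h : IsLRAdmissible ι nabla) : HSStructure ι where
  toHom Δ :=
    { toFun := fun D => ⟨mapRingHom (RingHom.fst R (Module.End k A)) (h.flow D), by
        change coeff 0 _ = 1
        rw [coeff_mapRingHom, (h.isFlow_flow D).1, map_one]⟩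
      map_one' := Subtype.ext (by
        change mapRingHom _ (h.flow 1) = 1
        rw [h.flow_eq (D := 1) isFlow_one (by rw [map_one]; rfl), map_one])
      map_mul' := fun D D' => Subtype.ext (by
        change mapRingHom _ (h.flow (D * D')) = mapRingHom _ (h.flow D) * mapRingHom _ (h.flow D')
        rw [h.flow_eq (D := D * D')
          ((h.isFlow_flow D).mul h.isLRSubmodule_graph (h.isFlow_flow D')) (by
            rw [map_mul, snd_flow, snd_flow]; rfl), map_mul]) }
  leibniz Δ D a := by
    have e := congrArg (mapRingHom (RingHom.fst R (Module.End k A))) (h.flow_leibniz D a)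
    rw [map_mul, map_mul, mapRingHom_C, fst_mapRingHom_prodHom] at e
    exact e
  subst Δ Γ φ D := by
    change mapRingHom _ (h.flow (φ.bulletHS D)) = φ.bullet ι.toRingHom (mapRingHom _ (h.flow D))
    -- `φ • Y` is again a flow and has second component `φ • D`; uniqueness does the rest.
    rw [h.flow_eq (D := φ.bulletHS D) ((h.isFlow_flow D).bullet h.isLRSubmodule_graph φ) (by
      rw [φ.mapRingHom_bullet, snd_flow]
      rfl), φ.mapRingHom_bullet]
    rfl

/-- In degree one the equation reads `Y_1 = l_1`, so `Y_1` lies in the graph, over `δ`. -/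
theorem nabla_hsStructure (h : IsLRAdmissible ι nabla) (δ : Derivation k A A) :
    h.hsStructure.nabla δ = nabla δ := by
  change coeff expOne (mapRingHom (RingHom.fst R (Module.End k A)) (h.flow (HS.ofDer δ))) = _
  obtain ⟨h0, l, hl, hd⟩ := h.isFlow_flow (HS.ofDer δ)
  have hl0 := coeff_zero_eq_zero_of_euler_eq_mul h0 hd
  have e := congrArg (coeff expOne) hd
  rw [coeff_euler, coeff_expOne_mul, hl0, zero_mul, zero_add, h0, mul_one, degree_expOne,
    one_smul] at e
  have hs := congrArg (coeff expOne) (h.snd_flow (HS.ofDer δ))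
  rw [coeff_mapRingHom, HS.coeff_ofDer] at hs
  have hg : coeff expOne (h.flow (HS.ofDer δ)) = h.graphMap δ :=
    h.snd_injOn_graph (e ▸ hl expOne) ⟨δ, rfl⟩ hs
  rw [coeff_mapRingHom, hg]
  rfl

end IsLRAdmissible

/-! ### Adjoining a variable `τ` of square zero. -/

theorem Finsupp.sum_antidiagonal_cons {M : Type*} [AddCommMonoid M] {p : ℕ} (n : ℕ)
    (α : Fin p →₀ ℕ) (F : (Fin (p + 1) →₀ ℕ) × (Fin (p + 1) →₀ ℕ) → M) :
    ∑ x ∈ Finset.HasAntidiagonal.antidiagonal (Finsupp.cons n α), F x =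
      ∑ a ∈ Finset.HasAntidiagonal.antidiagonal n, ∑ x ∈ Finset.HasAntidiagonal.antidiagonal α,
        F (Finsupp.cons a.1 x.1, Finsupp.cons a.2 x.2) := by
  have hadd : ∀ (a b : ℕ) (β γ : Fin p →₀ ℕ),
      Finsupp.cons a β + Finsupp.cons b γ = Finsupp.cons (a + b) (β + γ) := by
    intro a b β γ
    ext i
    refine Fin.cases ?_ (fun i => ?_) i <;> simp
  rw [← Finset.sum_product']
  refine Finset.sum_nbij' (fun x => ((x.1 0, x.2 0), (Finsupp.tail x.1, Finsupp.tail x.2)))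
    (fun y => (Finsupp.cons y.1.1 y.2.1, Finsupp.cons y.1.2 y.2.2)) ?_ ?_ ?_ ?_ ?_
  · rintro ⟨x, y⟩ h
    rw [Finset.HasAntidiagonal.mem_antidiagonal, ← Finsupp.cons_tail x, ← Finsupp.cons_tail y,
      hadd] at h
    rw [Finset.mem_product, Finset.HasAntidiagonal.mem_antidiagonal,
      Finset.HasAntidiagonal.mem_antidiagonal]
    constructor
    · simpa using DFunLike.congr_fun h 0
    · simpa using congrArg Finsupp.tail h
  · rintro ⟨⟨a, b⟩, β, γ⟩ h
    rw [Finset.mem_product, Finset.HasAntidiagonal.mem_antidiagonal,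
      Finset.HasAntidiagonal.mem_antidiagonal] at h
    rw [Finset.HasAntidiagonal.mem_antidiagonal, hadd, h.1, h.2]
  · rintro ⟨x, y⟩ _
    simp
  · rintro ⟨⟨a, b⟩, β, γ⟩ _
    simp
  · rintro ⟨x, y⟩ _
    simp

/-- The co-ideal `{0, 1} × Δ`. -/
def Coideal.dual {p : ℕ} (Δ : Coideal p) : Coideal (p + 1) where
  carrier := {x | x 0 ≤ 1 ∧ Finsupp.tail x ∈ Δ}
  nonempty' := ⟨0, Nat.zero_le _, by
    have : Finsupp.tail (0 : Fin (p + 1) →₀ ℕ) = 0 := by ext; simp [Finsupp.tail_apply]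
    rw [this]
    exact Δ.zero_mem⟩
  lower' x y hy h := ⟨(h 0).trans hy.1, Δ.mem_of_le hy.2 fun i => by
    rw [Finsupp.tail_apply, Finsupp.tail_apply]
    exact h _⟩

theorem Coideal.cons_mem_dual {p : ℕ} {Δ : Coideal p} {n : ℕ} {α : Fin p →₀ ℕ} :
    Finsupp.cons n α ∈ Δ.dual ↔ n ≤ 1 ∧ α ∈ Δ := by
  change _ ∧ _ ↔ _
  rw [Finsupp.cons_zero, Finsupp.tail_cons]

namespace TPS

variable {p : ℕ} {Δ : Coideal p} {R : Type*} [Ring R]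

theorem ext_dual {f g : TPS Δ.dual R} (h0 : ∀ α ∈ Δ, coeff (Finsupp.cons 0 α) f =
    coeff (Finsupp.cons 0 α) g) (h1 : ∀ α ∈ Δ, coeff (Finsupp.cons 1 α) f =
    coeff (Finsupp.cons 1 α) g) : f = g := by
  refine ext fun x hx => ?_
  rw [← Finsupp.cons_tail x] at hx ⊢
  generalize Finsupp.tail x = α at hx ⊢
  generalize x 0 = n at hx ⊢
  obtain ⟨hn, hα⟩ := Coideal.cons_mem_dual.1 hx
  interval_cases n
  · exact h0 α hα
  · exact h1 α hα

theorem coeff_cons_zero_mul {α : Fin p →₀ ℕ} (hα : α ∈ Δ) (f g : TPS Δ.dual R) :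
    coeff (Finsupp.cons 0 α) (f * g) = ∑ x ∈ Finset.HasAntidiagonal.antidiagonal α,
      coeff (Finsupp.cons 0 x.1) f * coeff (Finsupp.cons 0 x.2) g := by
  rw [coeff_mul (Coideal.cons_mem_dual.2 ⟨by omega, hα⟩), Finsupp.sum_antidiagonal_cons,
    Finset.HasAntidiagonal.antidiagonal_zero, Finset.sum_singleton]

theorem coeff_cons_one_mul {α : Fin p →₀ ℕ} (hα : α ∈ Δ) (f g : TPS Δ.dual R) :
    coeff (Finsupp.cons 1 α) (f * g) = ∑ x ∈ Finset.HasAntidiagonal.antidiagonal α,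
      (coeff (Finsupp.cons 0 x.1) f * coeff (Finsupp.cons 1 x.2) g +
        coeff (Finsupp.cons 1 x.1) f * coeff (Finsupp.cons 0 x.2) g) := by
  have h : Finset.HasAntidiagonal.antidiagonal 1 = {((0 : ℕ), 1), (1, 0)} := rfl
  rw [coeff_mul (Coideal.cons_mem_dual.2 ⟨le_rfl, hα⟩), Finsupp.sum_antidiagonal_cons, h,
    Finset.sum_pair (by simp), Finset.sum_add_distrib]

theorem cons_zero_eq_zero_iff {α : Fin p →₀ ℕ} : Finsupp.cons 0 α = 0 ↔ α = 0 :=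
  ⟨fun h => by
    have := congrArg Finsupp.tail (h.trans Finsupp.cons_zero_zero.symm)
    rwa [Finsupp.tail_cons, Finsupp.tail_cons] at this,
    fun h => by rw [h, Finsupp.cons_zero_zero]⟩

theorem cons_one_ne_zero (α : Fin p →₀ ℕ) : Finsupp.cons 1 α ≠ 0 := fun h => by
  simpa using DFunLike.congr_fun h 0

/-- The additive map `f ↦ τ f`, where `τ` is the new variable. -/
noncomputable def shift (f : TPS Δ R) : TPS Δ.dual R :=
  ofFun _ fun x => if x 0 = 0 then 0 else coeff (Finsupp.tail x) f

theorem coeff_cons_zero_shift (f : TPS Δ R) (α : Fin p →₀ ℕ) :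
    coeff (Finsupp.cons 0 α) (shift f) = 0 := by
  by_cases hα : Finsupp.cons 0 α ∈ Δ.dual
  · rw [shift, coeff_ofFun hα, Finsupp.cons_zero, if_pos rfl]
  · exact coeff_of_notMem hα _

theorem coeff_cons_one_shift (f : TPS Δ R) (α : Fin p →₀ ℕ) :
    coeff (Finsupp.cons 1 α) (shift f) = coeff α f := by
  by_cases hα : α ∈ Δ
  · rw [shift, coeff_ofFun (Coideal.cons_mem_dual.2 ⟨le_rfl, hα⟩), Finsupp.cons_zero,
      if_neg one_ne_zero, Finsupp.tail_cons]
  · rw [coeff_of_notMem hα, coeff_of_notMem fun h => hα (Coideal.cons_mem_dual.1 h).2]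

theorem shift_injective : Function.Injective (shift (Δ := Δ) (R := R)) := fun f g h => ext' fun α => by
  rw [← coeff_cons_one_shift, h, coeff_cons_one_shift]

/-- The ring homomorphism `s ^ α ↦ s ^ α (1 + w(α) τ)`, where `τ` is the new variable, of square
zero. -/
noncomputable def dilate (w : (Fin p →₀ ℕ) →+ ℕ) (f : TPS Δ R) : TPS Δ.dual R :=
  ofFun _ fun x => (if x 0 = 0 then 1 else w (Finsupp.tail x)) • coeff (Finsupp.tail x) f

variable (w : (Fin p →₀ ℕ) →+ ℕ)

theorem coeff_cons_zero_dilate (f : TPS Δ R) (α : Fin p →₀ ℕ) :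
    coeff (Finsupp.cons 0 α) (dilate w f) = coeff α f := by
  by_cases hα : α ∈ Δ
  · rw [dilate, coeff_ofFun (Coideal.cons_mem_dual.2 ⟨zero_le_one, hα⟩), Finsupp.cons_zero,
      if_pos rfl, one_smul, Finsupp.tail_cons]
  · rw [coeff_of_notMem hα, coeff_of_notMem fun h => hα (Coideal.cons_mem_dual.1 h).2]

theorem coeff_cons_one_dilate (f : TPS Δ R) (α : Fin p →₀ ℕ) :
    coeff (Finsupp.cons 1 α) (dilate w f) = w α • coeff α f := by
  by_cases hα : α ∈ Δ
  · rw [dilate, coeff_ofFun (Coideal.cons_mem_dual.2 ⟨le_rfl, hα⟩), Finsupp.cons_zero,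
      if_neg one_ne_zero, Finsupp.tail_cons]
  · rw [coeff_of_notMem hα, coeff_of_notMem fun h => hα (Coideal.cons_mem_dual.1 h).2, smul_zero]

theorem dilate_eq_add_shift (f : TPS Δ R) : dilate w f = dilate 0 f + shift (euler w f) := by
  refine ext_dual (fun α _ => ?_) (fun α _ => ?_)
  · rw [map_add, coeff_cons_zero_dilate, coeff_cons_zero_dilate, coeff_cons_zero_shift, add_zero]
  · rw [map_add, coeff_cons_one_dilate, coeff_cons_one_dilate, coeff_cons_one_shift, coeff_euler,
      AddMonoidHom.zero_apply, zero_smul, zero_add]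

theorem one_add_shift_mul_dilate_zero (f g : TPS Δ R) :
    (1 + shift f) * dilate 0 g = dilate 0 g + shift (f * g) := by
  rw [add_mul, one_mul]
  congr 1
  refine ext_dual (fun α hα => ?_) (fun α hα => ?_)
  · rw [coeff_cons_zero_mul hα, coeff_cons_zero_shift]
    exact Finset.sum_eq_zero fun x _ => by rw [coeff_cons_zero_shift, zero_mul]
  · rw [coeff_cons_one_mul hα, coeff_cons_one_shift, coeff_mul hα]
    refine Finset.sum_congr rfl fun x _ => ?_
    rw [coeff_cons_zero_shift, zero_mul, zero_add, coeff_cons_one_shift, coeff_cons_zero_dilate]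

/-- The dilation is `g + τ χ(g)`, and `dilate 0` is the inclusion `g ↦ g`. Comparing the
coefficients of `τ` turns the differential equation into an identity between products and dilations.
-/
theorem dilate_eq_one_add_shift_mul_iff {f g : TPS Δ R} :
    dilate w g = (1 + shift f) * dilate 0 g ↔ euler w g = f * g := by
  rw [dilate_eq_add_shift, one_add_shift_mul_dilate_zero, add_right_inj, shift_injective.eq_iff]

/-- The substitution map `s_i ↦ s_i (1 + w_i τ)`, where `τ` is the new variable, of square zero. -/
noncomputable def dilateSubst (A : Type*) [CommRing A] (Δ : Coideal p) : SubstMap A Δ Δ.dual where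
  toAlgHom :=
    { toFun := dilate w
      map_one' := ext_dual
        (fun α hα => by
          rw [coeff_cons_zero_dilate, coeff_one hα,
            coeff_one (Coideal.cons_mem_dual.2 ⟨zero_le_one, hα⟩)]
          simp only [cons_zero_eq_zero_iff])
        (fun α hα => by
          rw [coeff_cons_one_dilate, coeff_one hα,
            coeff_one (Coideal.cons_mem_dual.2 ⟨le_rfl, hα⟩), if_neg (cons_one_ne_zero α)]
          split_ifs with h
          · rw [h, map_zero, zero_smul]
          · rw [smul_zero])
      map_mul' := fun f g => ext_dual
        (fun α hα => by
          rw [coeff_cons_zero_dilate, coeff_cons_zero_mul hα, coeff_mul hα]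
          simp only [coeff_cons_zero_dilate])
        (fun α hα => by
          rw [coeff_cons_one_dilate, coeff_cons_one_mul hα, coeff_mul hα, Finset.smul_sum]
          refine Finset.sum_congr rfl fun x hx => ?_
          rw [coeff_cons_zero_dilate, coeff_cons_zero_dilate, coeff_cons_one_dilate,
            coeff_cons_one_dilate, ← Finset.HasAntidiagonal.mem_antidiagonal.1 hx, map_add,
            add_smul, smul_mul_assoc, mul_smul_comm, add_comm])
      map_zero' := ext_dual
        (fun α hα => by rw [coeff_cons_zero_dilate, map_zero, map_zero])
        (fun α hα => by rw [coeff_cons_one_dilate, map_zero, map_zero, smul_zero])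
      map_add' := fun f g => ext_dual
        (fun α hα => by simp only [map_add, coeff_cons_zero_dilate])
        (fun α hα => by simp only [map_add, coeff_cons_one_dilate, smul_add])
      commutes' := fun a => ext_dual
        (fun α hα => by
          rw [coeff_cons_zero_dilate, coeff_algebraMap hα,
            coeff_algebraMap (Coideal.cons_mem_dual.2 ⟨zero_le_one, hα⟩)]
          simp only [cons_zero_eq_zero_iff])
        (fun α hα => by
          rw [coeff_cons_one_dilate, coeff_algebraMap hα,
            coeff_algebraMap (Coideal.cons_mem_dual.2 ⟨le_rfl, hα⟩), if_neg (cons_one_ne_zero α)]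
          split_ifs with h
          · rw [h, map_zero, zero_smul]
          · rw [smul_zero]) }
  ord_pos i := by
    change coeff 0 (dilate w _) = (0 : A)
    rw [← Finsupp.cons_zero_zero, coeff_cons_zero_dilate, coeff_monomial Δ.zero_mem,
      if_neg (by simp [eq_comm])]

/-- The dilation of `s ^ β` has natural number coefficients, so the action does not depend on the
structure map. The same formula therefore holds in `End_k(A)` and in `R`. -/
theorem dilateSubst_bullet {A : Type*} [CommRing A] (j : A →+* R) (r : TPS Δ R) :
    (dilateSubst w A Δ).bullet j r = dilate w r := by
  have h0 : ∀ (α : Fin p →₀ ℕ) (β : Fin p →₀ ℕ), α ∈ Δ →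
      coeff α (monomial Δ β (1 : A)) = if β = α then 1 else 0 := fun α β hα => by
    rw [coeff_monomial hα]
    simp only [eq_comm]
  have hd : ∀ (n : ℕ) (α : Fin p →₀ ℕ), α ∈ degreeLE p (Finsupp.cons n α).degree := by
    intro n α
    rw [mem_degreeLE, Finsupp.degree_eq_sum, Finsupp.degree_eq_sum, Fin.sum_univ_succ]
    simp
  refine ext_dual (fun α hα => ?_) (fun α hα => ?_)
  · rw [(dilateSubst w A Δ).coeff_bullet _ _ (Coideal.cons_mem_dual.2 ⟨zero_le_one, hα⟩)]
    change ∑ β ∈ _, j (coeff _ (dilate w _)) * _ = _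
    simp only [coeff_cons_zero_dilate, h0 _ _ hα]
    simp [hd]
  · rw [(dilateSubst w A Δ).coeff_bullet _ _ (Coideal.cons_mem_dual.2 ⟨le_rfl, hα⟩)]
    change ∑ β ∈ _, j (coeff _ (dilate w _)) * _ = _
    simp only [coeff_cons_one_dilate, h0 _ _ hα, smul_ite, smul_zero, apply_ite j, map_zero, ite_mul,
      zero_mul, Finset.sum_ite_eq', hd, if_true, nsmul_eq_mul]
    rw [mul_one, map_natCast]

theorem two_cons_one_notMem (β γ : Fin p →₀ ℕ) : Finsupp.cons 1 β + Finsupp.cons 1 γ ∉ Δ.dual :=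
  fun h => by
    have := h.1
    simp at this

theorem list_prod_one_add_monomial (r : (Fin p →₀ ℕ) → R) (l : List (Fin p →₀ ℕ)) :
    (l.map fun β => 1 + monomial Δ.dual (Finsupp.cons 1 β) (r β)).prod =
      1 + (l.map fun β => monomial Δ.dual (Finsupp.cons 1 β) (r β)).sum := by
  induction l with
  | nil => simp
  | cons β l ih =>
    have hz : monomial Δ.dual (Finsupp.cons 1 β) (r β) *
        (l.map fun β => monomial Δ.dual (Finsupp.cons 1 β) (r β)).sum = 0 := by
      clear ih
      induction l with
      | nil => simp
      | cons γ l ih =>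
        rw [List.map_cons, List.sum_cons, mul_add, ih, monomial_mul,
          monomial_of_notMem (two_cons_one_notMem β γ), add_zero]
    rw [List.map_cons, List.prod_cons, ih, List.map_cons, List.sum_cons, add_mul, one_mul, mul_add,
      hz, mul_one]
    abel

/-- Because `τ² = 0`, a product of factors `1 + τ r_β s ^ β` is `1` plus a sum, in whatever order.
Restricting to the indices below `α` keeps the product finite. -/
theorem list_prod_below (α : Fin p →₀ ℕ) (r : (Fin p →₀ ℕ) → R) :
    ((Finset.Iic α).toList.map fun β =>
      1 + monomial (Coideal.below α).dual (Finsupp.cons 1 β) (r β)).prod =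
      1 + shift (ofFun (Coideal.below α) r) := by
  rw [list_prod_one_add_monomial, Finset.sum_map_toList]
  congr 1
  refine ext_dual (fun γ hγ => ?_) (fun γ hγ => ?_)
  · rw [coeff_cons_zero_shift, map_sum]
    refine Finset.sum_eq_zero fun β _ => ?_
    rw [coeff_monomial (Coideal.cons_mem_dual.2 ⟨zero_le_one, hγ⟩), if_neg]
    intro h
    simpa using DFunLike.congr_fun h 0
  · rw [coeff_cons_one_shift, map_sum, coeff_ofFun hγ, Finset.sum_eq_single γ]
    · rw [coeff_monomial (Coideal.cons_mem_dual.2 ⟨le_rfl, hγ⟩), if_pos rfl]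
    · intro β _ hβ
      rw [coeff_monomial (Coideal.cons_mem_dual.2 ⟨le_rfl, hγ⟩), if_neg]
      intro h
      exact hβ (by simpa using (congrArg Finsupp.tail h).symm)
    · intro h
      exact absurd (Finset.mem_Iic.2 (Coideal.mem_below.1 hγ)) h

end TPS

/-! ### The logarithmic derivative in an arbitrary HS-structure. -/

namespace HSStructure

open TPS

variable {k A R : Type*} [CommRing k] [CommRing A] [Algebra k A] [Ring R] [Algebra k R]
  {ι : A →ₐ[k] R} {p : ℕ}

/-- The logarithmic derivative of `Ψ(D)` is the image under `∇` of that of `D`. -/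
theorem euler_toHom (Ψ : HSStructure ι) {α : Fin p →₀ ℕ} (D : HS k A (Coideal.below α))
    {ε : (Fin p →₀ ℕ) → Derivation k A A}
    (hε : euler Finsupp.degree (D : TPS (Coideal.below α) (Module.End k A)) =
      ofFun _ (fun β => ((ε β : A →ₗ[k] A) : Module.End k A)) *
        (D : TPS (Coideal.below α) (Module.End k A))) :
    euler Finsupp.degree (Ψ.toHom _ D : TPS (Coideal.below α) R) =
      ofFun _ (fun β => Ψ.nabla (ε β)) * (Ψ.toHom _ D : TPS (Coideal.below α) R) := by
  -- `B β = Id + τ s ^ β ε_β` is obtained from `Id + ε_β s` by the substitution `s ↦ τ s ^ β`, so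
  -- `Ψ` sends it to `1 + τ s ^ β ∇(ε_β)`. The product `P` is `Id + τ ε`.
  let B : (Fin p →₀ ℕ) → HS k A (Coideal.below α).dual := fun β =>
    (SubstMap.ofMonomial (Finsupp.cons 1 β) (cons_one_ne_zero β) (two_cons_one_notMem β β)
      (1 : A)).bulletHS (HS.ofDer (ε β))
  let P : HS k A (Coideal.below α).dual := ((Finset.Iic α).toList.map B).prod
  have hP : (P : TPS (Coideal.below α).dual (Module.End k A)) =
      1 + shift (ofFun _ fun β => ((ε β : A →ₗ[k] A) : Module.End k A)) := by
    rw [← list_prod_below, Submonoid.coe_list_prod, List.map_map]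
    congr 2
    funext β
    refine (coe_bulletHS_ofDer ..).trans ?_
    rw [one_smul]
  have hΨP : (Ψ.toHom _ P : TPS (Coideal.below α).dual R) =
      1 + shift (ofFun _ fun β => Ψ.nabla (ε β)) := by
    rw [← list_prod_below, map_list_prod, Submonoid.coe_list_prod, List.map_map, List.map_map]
    congr 2
    funext β
    refine (Ψ.toHom_bullet_ofDer ..).trans ?_
    rw [map_one, one_mul]
  -- The equation `χ(D) = ε D` as an identity of Hasse–Schmidt derivations, to which `Ψ` can be
  -- applied.
  have h : (dilateSubst Finsupp.degree A (Coideal.below α)).bulletHS D =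
      P * (dilateSubst 0 A (Coideal.below α)).bulletHS D := by
    refine Subtype.ext ?_
    change (dilateSubst Finsupp.degree A (Coideal.below α)).bullet _ _ =
      (P : TPS (Coideal.below α).dual (Module.End k A)) *
        (dilateSubst 0 A (Coideal.below α)).bullet _ _
    rw [dilateSubst_bullet, dilateSubst_bullet, hP]
    exact (dilate_eq_one_add_shift_mul_iff _).2 hε
  have h' := congrArg (fun w => (Ψ.toHom _ w : TPS (Coideal.below α).dual R)) h
  simp only [map_mul, Submonoid.coe_mul, Ψ.subst, dilateSubst_bullet, hΨP] at h'
  exact (dilate_eq_one_add_shift_mul_iff _).1 h'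

end HSStructure

/-! ### Filtrations and bijectivity of `κ`. -/

theorem wordFil_le_of_mul_mem {k U X : Type*} [CommRing k] [Ring U] [Algebra k U] {g : X → U}
    {w : X → ℕ} {F : ℕ → Submodule k U} (hF : Monotone F) (h1 : 1 ∈ F 0)
    (hmul : ∀ d e, ∀ u ∈ F d, ∀ v ∈ F e, u * v ∈ F (d + e)) (hg : ∀ x, g x ∈ F (w x)) (d : ℕ) :
    wordFil k g w d ≤ F d := by
  refine Submodule.span_le.2 ?_
  rintro _ ⟨l, hl, rfl⟩
  refine hF hl ?_
  clear hl
  induction l with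
  | nil => simpa using h1
  | cons x l ih =>
    rw [List.map_cons, List.map_cons, List.prod_cons, List.sum_cons]
    exact hmul _ _ _ (hg x) _ ih

theorem one_mem_wordFil {k U X : Type*} [CommRing k] [Ring U] [Algebra k U] (g : X → U) (w : X → ℕ)
    (d : ℕ) : 1 ∈ wordFil k g w d :=
  Submodule.subset_span ⟨[], by simp, by simp⟩

section Kappa

open TPS

variable {k A : Type*} [CommRing k] [CommRing A] [Algebra k A]

theorem ULR.σ_mem_fil (δ : Derivation k A A) : ULR.σ k A δ ∈ ULR.fil (k := k) (A := A) 1 :=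
  gen_mem_wordFil _ LRGen.weight (LRGen.der δ)

theorem ULR.mul_mem_fil {d e : ℕ} {u v : ULR k A} (hu : u ∈ ULR.fil (k := k) (A := A) d)
    (hv : v ∈ ULR.fil (k := k) (A := A) e) : u * v ∈ ULR.fil (k := k) (A := A) (d + e) :=
  mul_mem_wordFil hu hv

theorem UHS.coeff_univ {p : ℕ} {Δ : Coideal p} (D : HS k A Δ) {α : Fin p →₀ ℕ} (hα : α ∈ Δ) :
    coeff α ((UHS.univ k A).toHom Δ D : TPS Δ (UHS k A)) = UHS.comp D α := coeff_ofFun hα _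

theorem UHS.comp_mem_fil {p : ℕ} {Δ : Coideal p} (D : HS k A Δ) {α : Fin p →₀ ℕ} (hα : α ∈ Δ) :
    UHS.comp D α ∈ UHS.fil (k := k) (A := A) α.degree := by
  rw [UHS.comp, HSGen.d, dif_pos hα]
  exact gen_mem_wordFil _ HSGen.weight (HSGen.comp Δ D α hα)

theorem UHS.nabla_univ (δ : Derivation k A A) :
    (UHS.univ k A).nabla δ = UHS.comp (HS.ofDer δ) expOne :=
  UHS.coeff_univ _ (Coideal.mem_below.2 le_rfl)

theorem UHS.comp_bulletHS_proj {p : ℕ} {Δ Δ' : Coideal p} (h : ∀ α, α ∈ Δ' → α ∈ Δ) (D : HS k A Δ)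
    {α : Fin p →₀ ℕ} (hα : α ∈ Δ') :
    UHS.comp ((SubstMap.proj h A).bulletHS D) α = UHS.comp D α := by
  rw [← UHS.coeff_univ _ hα, (UHS.univ k A).subst, SubstMap.coeff_proj_bullet h _ _ hα,
    UHS.coeff_univ _ (h α hα)]

theorem map_fil_le (d : ℕ) :
    (ULR.fil d).map (kappa k A).toLinearMap ≤ (UHS.fil d : Submodule k (UHS k A)) := by
  rw [Submodule.map_le_iff_le_comap]
  refine wordFil_le_of_mul_mem (F := fun d => (UHS.fil d).comap (kappa k A).toLinearMap)
    (fun _ _ h => Submodule.comap_mono (wordFil_mono _ _ _ h)) ?_ ?_ ?_ d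
  · change kappa k A 1 ∈ UHS.fil (k := k) (A := A) 0
    rw [map_one]
    exact one_mem_wordFil _ _ _
  · intro d e u hu v hv
    change kappa k A (u * v) ∈ UHS.fil (k := k) (A := A) (d + e)
    rw [map_mul]
    exact mul_mem_wordFil hu hv
  · rintro (a | δ)
    · change kappa k A (ULR.ι k A a) ∈ UHS.fil (k := k) (A := A) 0
      rw [kappa_ι]
      exact gen_mem_wordFil _ HSGen.weight (HSGen.coef a)
    · change kappa k A (ULR.σ k A δ) ∈ UHS.fil (k := k) (A := A) 1
      rw [kappa_σ, UHS.nabla_univ]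
      have := UHS.comp_mem_fil (HS.ofDer δ) (Coideal.mem_below.2 (le_refl expOne))
      rwa [show Finsupp.degree (expOne : Fin 1 →₀ ℕ) = 1 from degree_expOne] at this

variable [Algebra ℚ k]

/-- Restricted to the exponents below `α`, the logarithmic derivative formula gives `|α| Υ(D)_α = ∑
κ(σ(ε_β)) Υ(D)_γ`. The term with `β = 0` vanishes as `ε_0 = 0`; in the others `|γ| < |α|`, and the
factor `σ(ε_β)` costs only weight one. -/
theorem comp_mem_map_fil {p : ℕ} {Δ : Coideal p} (D : HS k A Δ) {α : Fin p →₀ ℕ} (hα : α ∈ Δ) :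
    UHS.comp D α ∈ (ULR.fil α.degree).map (kappa k A).toLinearMap := by
  induction hn : α.degree using Nat.strong_induction_on generalizing α with
  | _ n ih =>
    by_cases hc : n = 0
    · rw [(Finsupp.degree_eq_zero_iff _).1 (hn.trans hc), UHS.comp_zero]
      exact ⟨1, one_mem_wordFil _ _ _, map_one (kappa k A)⟩
    have hb : ∀ β, β ∈ Coideal.below α → β ∈ Δ := fun β hβ => Δ.mem_of_le hα hβ
    have hαα : α ∈ Coideal.below α := Coideal.mem_below.2 le_rfl
    obtain ⟨ε, h0, hε⟩ := HS.exists_euler_eq_derivation_mul ((SubstMap.proj hb A).bulletHS D)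
    have h := congrArg (coeff α) ((UHS.univ k A).euler_toHom _ hε)
    rw [coeff_euler, coeff_mul hαα, UHS.coeff_univ _ hαα, UHS.comp_bulletHS_proj hb D hαα, hn] at h
    refine Submodule.mem_of_nsmul_mem_of_rat _ hc ?_
    rw [h]
    refine Submodule.sum_mem _ fun x hx => ?_
    have hx1 := (Coideal.below α).fst_mem hαα hx
    have hx2 := (Coideal.below α).snd_mem hαα hx
    rw [coeff_ofFun hx1, UHS.coeff_univ _ hx2, UHS.comp_bulletHS_proj hb D hx2, ← kappa_σ]
    by_cases hx0 : x.1 = 0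
    · have hz : ULR.σ k A 0 = 0 := by simpa using (ULR.isLRAdmissible_σ k A).map_smul 0 0
      rw [hx0, h0, hz, map_zero, zero_mul]
      exact Submodule.zero_mem _
    · have hlt : x.2.degree < n := hn ▸ Finsupp.degree_snd_lt_of_mem_antidiagonal hx hx0
      obtain ⟨u, hu, hu'⟩ := ih _ hlt (hb _ hx2) rfl
      have hu'' : kappa k A u = UHS.comp D x.2 := hu'
      refine ⟨ULR.σ k A (ε x.1) * u, wordFil_mono _ _ _ (by omega : 1 + x.2.degree ≤ n)
        (ULR.mul_mem_fil (ULR.σ_mem_fil _) hu), ?_⟩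
      rw [← hu'']
      exact map_mul (kappa k A) _ _

theorem fil_le_map_fil (d : ℕ) :
    (UHS.fil d : Submodule k (UHS k A)) ≤ (ULR.fil d).map (kappa k A).toLinearMap := by
  refine wordFil_le_of_mul_mem (F := fun d => (ULR.fil d).map (kappa k A).toLinearMap)
    (fun _ _ h => Submodule.map_mono (wordFil_mono _ _ _ h)) ?_ ?_ ?_ d
  · exact ⟨1, one_mem_wordFil _ _ _, map_one (kappa k A)⟩
  · rintro d e _ ⟨u, hu, rfl⟩ _ ⟨v, hv, rfl⟩
    exact ⟨u * v, mul_mem_wordFil hu hv, map_mul (kappa k A) u v⟩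
  · rintro (a | ⟨Δ, D, α, hα⟩)
    · exact ⟨ULR.ι k A a, gen_mem_wordFil _ LRGen.weight (LRGen.coef a), kappa_ι k A a⟩
    · have := comp_mem_map_fil D hα
      rwa [UHS.comp, HSGen.d, dif_pos hα] at this

variable (k A)

/-- The HS-structure that `σ` induces on `U^LR` yields a map `U^HS → U^LR`. Composed with `κ` it
fixes `A` and every `σ(δ)`, hence is the identity. -/
theorem kappa_injective : Function.Injective (kappa k A) := by
  let h := ULR.isLRAdmissible_σ k A
  have hid : (UHS.lift h.hsStructure).comp (kappa k A) = AlgHom.id k (ULR k A) := by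
    refine ULR.hom_ext (fun a => ?_) (fun δ => ?_)
    · rw [AlgHom.comp_apply, kappa_ι, UHS.lift_ι]
      rfl
    · rw [AlgHom.comp_apply, kappa_σ]
      refine Eq.trans ?_ (h.nabla_hsStructure δ)
      rw [HSStructure.nabla, HSStructure.nabla, ← UHS.lift_univ h.hsStructure, coeff_mapCoeff]
      rfl
  exact Function.LeftInverse.injective (g := UHS.lift h.hsStructure) fun x =>
    DFunLike.congr_fun hid x

/-- Each generator of `U^HS` lies in the filtration step of its weight, hence in the image of `κ`.
-/
theorem kappa_surjective : Function.Surjective (kappa k A) := by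
  intro u
  obtain ⟨x, rfl⟩ := RingQuot.mkAlgHom_surjective k (HSRel k A) u
  change _ ∈ (kappa k A).range
  induction x using FreeAlgebra.induction with
  | grade0 r => rw [AlgHom.commutes]; exact Subalgebra.algebraMap_mem _ r
  | grade1 x =>
    obtain ⟨u, _, hu⟩ := fil_le_map_fil (HSGen.weight x)
      (gen_mem_wordFil (fun x => RingQuot.mkAlgHom k (HSRel k A) (FreeAlgebra.ι k x))
        HSGen.weight x)
    exact ⟨u, hu⟩
  | mul a b ha hb => rw [map_mul]; exact Subalgebra.mul_mem _ ha hb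
  | add a b ha hb => rw [map_add]; exact Subalgebra.add_mem _ ha hb

end Kappa

/-- If `ℚ ⊂ k`, then `κ : U^LR → U^HS` is an isomorphism of filtered `k`-algebras over `A`. -/
theorem mainTheorem2 (k A : Type*) [CommRing k] [CommRing A] [Algebra k A] [Algebra ℚ k] :
    ∃ e : ULR k A ≃ₐ[k] UHS k A,
      (∀ x : ULR k A, e x = kappa k A x) ∧
      (∀ a : A, e (ULR.ι k A a) = UHS.ι k A a) ∧
      (∀ d : ℕ, (ULR.fil d).map e.toLinearMap = (UHS.fil d : Submodule k (UHS k A))) :=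
  ⟨AlgEquiv.ofBijective (kappa k A) ⟨kappa_injective k A, kappa_surjective k A⟩, fun _ => rfl,
    kappa_ι k A, fun d => le_antisymm (map_fil_le d) (fil_le_map_fil d)⟩
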